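/- **Lemma (interpolation errors on the coarser mesh).** Let $k\ge 1$ be an integer, $\beta,\gamma>0$, $\sigma\ge k+1$, and let $0=\xi_0<\xi_1<\dots<\xi_k=1$ be fixed reference interpolation points. Let $\Omega=(0,2)$, $0<\varepsilon\le 1$, and let $N\ge 4$ be divisible by $4$. *Mesh.* Put $\lambda=\frac{\sigma\varepsilon}{\beta}\ln N$, and $\mu=\frac{1}{\beta}\varepsilon^{(k-1)/k}$ for $k\ge 2$, $\mu=\frac12$ for $k=1$; assume $\lambda\le\frac12$ and $\mu\le\frac12$. Let $\phi$ be continuous and increasing on $[0,\frac12]$ with $\phi(0)=0$, $\phi(\frac12)=\ln N$, differentiable up to finitely many points, put $\psi=\mathrm e^{-\phi}$ with $\psi'$ bounded, and let $\max|\psi'|$ be the supremum of $|\psi'|$ over $[0,\frac12]$ (without the exceptional points). The mesh nodes are $$x_i=\begin{cases}\frac{\sigma\varepsilon}{\beta}\phi\left(\frac{2i}{N}\right),&0\le i\le \frac N4,\\ \frac{4i}{N}(1-\lambda)+2\lambda-1,&\frac N4\le i\le\frac N2,\\ 1+\mu\left(\frac{4i}{N}-2\right),&\frac N2\le i\le\frac{3N}4,\\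 \frac{4i}{N}(1-\mu)+4\mu-2,&\frac{3N}4\le i\le N.\end{cases}$$ Let $h_1=\max_{1\le i\le N/4}(x_i-x_{i-1})$ be the mesh width in $(0,\lambda)$, and assume $h_1\le K_1\varepsilon$. *Functions.* Let $u\in C[0,2]$ with $u(0)=u(2)=0$ satisfy $u=S+E+W$ on $(0,1)\cup(1,2)$, where $S\in H^{k+1}(0,1)$ and $S\in H^{k+1}(1,2)$ (continuous representatives), $E\in C^{k+1}(0,2)$, $W\in C^{k+1}(1,2)$, $W=0$ on $(0,1)$, and for all $0\le\ell\le k+1$ $$\|S^{(\ell)}\|_{L^2(0,1)}+\|S^{(\ell)}\|_{L^2(1,2)}\le K,\qquad |E^{(\ell)}(x)|\le K\varepsilon^{-\ell}\mathrm e^{-\beta x/\varepsilon}\ (0<x<2),\qquad |W^{(\ell)}(x)|\le K\varepsilon^{1-\ell}\mathrm e^{-\beta(x-1)/\varepsilon}\ (1<x<2).$$ (This is the solution decomposition of the convection-diffusion problem $-\varepsilon u''-bu'+cu+d\,u(\cdot-1)=f$ on $\Omega$ with $b\ge\beta$; in particular $u\in H_0^1(\Omega)$.) For a function $v$, let $Iv$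 be its piecewise Lagrange interpolant of degree $k$: on each cell $(x_{i-1},x_i)$ it interpolates $v$ in the points $x_{i-1}+(x_i-x_{i-1})\xi_j$, where the values of $v$ at the end points of the cell are the limits from inside the cell ($S$ and $W$ may jump at $x=1$). Let $|||v|||=\left(\varepsilon\|v'\|_{L^2(\Omega)}^2+\gamma\|v\|_{L^2(\Omega)}^2\right)^{1/2}$, with $v'$ the weak derivative on $\Omega$. *Claim.* There is a constant $C$ depending only on $k,\beta,\gamma,\sigma,K,K_1$ and $\xi_0,\dots,\xi_k$, not on $\varepsilon$, $N$, $\phi$ and $u,S,E,W$, such that, whenever $\mathrm e^{-\varepsilon^{-1/k}}\le N^{1-k}$, the function $u-Iu$ has a weak derivative in $L^2(\Omega)$ and $$\|u-Iu\|_{L^2(\Omega)}\le C\,(h_1+N^{-1}\max|\psi'|)^{k+1/2},\qquad |||u-Iu|||\le C\,(h_1+N^{-1}\max|\psi'|)^{k},$$ $$\|W-IW\|_{L^2(\Omega)}\le C\,\varepsilon^{1/2}N^{-k},\qquad \|E-IE\|_{L^2((\lambda,1)\cup(1+\mu,2))}\le C\,N^{-(k+1)},$$ $$\|E-IE\|_{L^2((0,\lambda)\cup(1,1+\mu))}\le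 C\,\varepsilon^{1/2}(N^{-1}\max|\psi'|)^k.$$ -/

import Mathlib

open MeasureTheory Set Filter Topology
open scoped ENNReal ContDiff

noncomputable section

namespace CoarseMesh

/-! ### Norms and weak derivatives on intervals -/

/-- The norm of `L²(D)`, with value `∞` when it is not finite. -/
def L2norm (v : ℝ → ℝ) (D : Set ℝ) : ℝ≥0∞ :=
  eLpNorm v 2 (volume.restrict D)

/-- `g` is the weak derivative of `v` on the open interval `(a, b)`. -/
def HasWeakDeriv (a b : ℝ) (v g : ℝ → ℝ) : Prop :=
  LocallyIntegrableOn v (Ioo a b) ∧ LocallyIntegrableOn g (Ioo a b) ∧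
    ∀ η : ℝ → ℝ, ContDiff ℝ ∞ η → HasCompactSupport η → tsupport η ⊆ Ioo a b →
      ∫ x in Ioo a b, v x * deriv η x = -∫ x in Ioo a b, g x * η x

/-- The energy norm `(ε ‖v'‖² + γ ‖v‖²)^{1/2}` on `Ω = (0, 2)`, where `v'` is the weak derivative
of `v` on the whole of `Ω`. As `v'` is unique up to null sets, the infimum runs over a
single value if `v` has a weak derivative; the norm is `∞` if it has none. -/
def energyNorm (ε γ : ℝ) (v : ℝ → ℝ) : ℝ≥0∞ :=
  ⨅ (g : ℝ → ℝ) (_ : HasWeakDeriv 0 2 v g),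
    (ENNReal.ofReal ε * L2norm g (Ioo 0 2) ^ 2 +
      ENNReal.ofReal γ * L2norm v (Ioo 0 2) ^ 2) ^ (1 / 2 : ℝ)

/-! ### The mesh -/

/-- The mesh characterising function `ψ = exp (-φ)`. -/
def psi (φ : ℝ → ℝ) (t : ℝ) : ℝ := Real.exp (-φ t)

/-- `max |ψ'|` over `[0, 1/2]`; finitely many points where `ψ` is not differentiable do not
contribute. -/
def maxAbsDerivPsi (φ : ℝ → ℝ) : ℝ :=
  sSup ((fun t => |deriv (psi φ) t|) '' Ioo 0 (1 / 2))

/-- `φ` is a mesh defining function for `N` cells: continuous and increasing on `[0, 1/2]`, with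
`φ 0 = 0` and `φ (1/2) = ln N`, differentiable up to finitely many points, with `ψ'` bounded. -/
structure IsMeshFunction (N : ℕ) (φ : ℝ → ℝ) : Prop where
  continuousOn : ContinuousOn φ (Icc 0 (1 / 2))
  monotoneOn : MonotoneOn φ (Icc 0 (1 / 2))
  map_zero : φ 0 = 0
  map_half : φ (1 / 2) = Real.log N
  differentiableAt : ∃ P : Finset ℝ, ∀ t ∈ Ioo (0 : ℝ) (1 / 2), t ∉ P → DifferentiableAt ℝ φ t
  bddAbove : BddAbove ((fun t => |deriv (psi φ) t|) '' Ioo 0 (1 / 2))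

/-- The transition point `λ` of the strong layer. -/
def lam (β σ ε : ℝ) (N : ℕ) : ℝ := σ * ε / β * Real.log N

/-- The transition parameter `μ` of the weak layer, which is `1/2` for `k = 1`. -/
def mu (k : ℕ) (β ε : ℝ) : ℝ :=
  if k = 1 then 1 / 2 else ε ^ (((k : ℝ) - 1) / k) / β

/-- The nodes `x_i`, `0 ≤ i ≤ N`, of the coarser mesh. -/
def node (k : ℕ) (β σ ε : ℝ) (N : ℕ) (φ : ℝ → ℝ) (i : ℕ) : ℝ :=
  if 4 * i ≤ N then σ * ε / β * φ (2 * i / N)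
  else if 2 * i ≤ N then 4 * i / N * (1 - lam β σ ε N) + 2 * lam β σ ε N - 1
  else if 4 * i ≤ 3 * N then 1 + mu k β ε * (4 * i / N - 2)
  else 4 * i / N * (1 - mu k β ε) + 4 * mu k β ε - 2

/-- The (largest) mesh width `h₁` in the strong layer region `(0, λ)`. -/
def h₁ (k : ℕ) (β σ ε : ℝ) (N : ℕ) (φ : ℝ → ℝ) : ℝ :=
  ⨆ i : Fin (N / 4), (node k β σ ε N φ (i + 1) - node k β σ ε N φ i)

/-! ### Lagrange interpolation -/

/-- The Lagrange interpolation polynomial of degree at most `k` of `v` on the cell `(a, b)`, in the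
points `a + (b - a) ξ_j`. The values of `v` are limits from inside the cell. They are the usual
values where `v` is continuous, and one-sided limits at an end point of the cell where `v` jumps. -/
def cellInterp {k : ℕ} (ξ : Fin (k + 1) → ℝ) (a b : ℝ) (v : ℝ → ℝ) : Polynomial ℝ :=
  Lagrange.interpolate Finset.univ (fun j => a + (b - a) * ξ j)
    (fun j => extendFrom (Ioo a b) v (a + (b - a) * ξ j))

/-- The piecewise Lagrange interpolant `Iv` on the mesh `x 0 ≤ x 1 ≤ … ≤ x N`. -/
def interp {k : ℕ} (ξ : Fin (k + 1) → ℝ) (N : ℕ) (x : ℕ → ℝ) (v : ℝ → ℝ) (y : ℝ) : ℝ :=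
  ∑ i ∈ Finset.range N,
    (Ico (x i) (x (i + 1))).indicator (fun z => (cellInterp ξ (x i) (x (i + 1)) v).eval z) y

/-! ### The solution decomposition -/

/-- `v` is the continuous representative of a function in `H^m(0,1)` and in `H^m(1,2)`, and
`‖v^(ℓ)‖_{L²(0,1)} + ‖v^(ℓ)‖_{L²(1,2)} ≤ K` for all `ℓ ≤ m`; here `D ℓ` is `v^(ℓ)`. -/
def BrokenSobolevBound (m : ℕ) (K : ℝ) (v : ℝ → ℝ) : Prop :=
  ContinuousOn v (Ioo 0 1) ∧ ContinuousOn v (Ioo 1 2) ∧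
    ∃ D : ℕ → ℝ → ℝ, D 0 = v ∧
      (∀ ℓ < m, HasWeakDeriv 0 1 (D ℓ) (D (ℓ + 1)) ∧ HasWeakDeriv 1 2 (D ℓ) (D (ℓ + 1))) ∧
      ∀ ℓ ≤ m, L2norm (D ℓ) (Ioo 0 1) + L2norm (D ℓ) (Ioo 1 2) ≤ ENNReal.ofReal K

/-- `u = S + E + W` with a smooth part `S`, a strong layer part `E` and a weak layer part
`W`, where `K` is the constant in the bounds on their derivatives up to order `m`. `S` and `W` may
jump at `1`. Continuity of `u`, its boundary values and the bounds give `u ∈ H¹₀(0,2)`. -/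
structure IsDecomposition (m : ℕ) (β ε K : ℝ) (u S E W : ℝ → ℝ) : Prop where
  continuousOn_u : ContinuousOn u (Icc 0 2)
  u_zero : u 0 = 0
  u_two : u 2 = 0
  eq_add : ∀ x ∈ Ioo (0 : ℝ) 1 ∪ Ioo 1 2, u x = S x + E x + W x
  bound_S : BrokenSobolevBound m K S
  contDiffOn_E : ContDiffOn ℝ m E (Ioo 0 2)
  bound_E : ∀ ℓ ≤ m, ∀ x ∈ Ioo (0 : ℝ) 2,
    |iteratedDeriv ℓ E x| ≤ K * ε ^ (-(ℓ : ℝ)) * Real.exp (-β * x / ε)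
  W_eq_zero : ∀ x ∈ Ioo (0 : ℝ) 1, W x = 0
  contDiffOn_W : ContDiffOn ℝ m W (Ioo 1 2)
  bound_W : ∀ ℓ ≤ m, ∀ x ∈ Ioo (1 : ℝ) 2,
    |iteratedDeriv ℓ W x| ≤ K * ε ^ (1 - (ℓ : ℝ)) * Real.exp (-β * (x - 1) / ε)

end CoarseMesh

end

/-!
On a cell of width `r` the Lagrange interpolant of degree `k` reproduces the Taylor polynomial of
the integrated function at the left end, and a Lebesgue bound for the reference points reduces the
interpolation error to the Taylor remainder, hence to `r ^ (m + 1 / 2)` times the `L²` norm of the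
derivative of order `m + 1` on the cell.

* On the layer cells in `(0, λ)`, `E⁽ᵐ⁾` grows like `ε⁻ᵐ` but the cell width is at most a multiple
  of `ε N⁻¹ max |ψ'| exp (β x / (σ ε))`. As `σ ≥ k + 1`, the decay of `E` absorbs the growth of
  the width for all orders up to `k + 1`. To the right of `λ`, `E` itself is below `N⁻ᵏ⁻¹`.
* On `(1, 1 + μ)` the weak layer gains a factor `ε` over `E`, so that a uniform mesh of width
  `4 μ / N` with `μ ~ ε^((k-1)/k)` is fine enough; beyond `1 + μ` the condition
  `exp (-ε^(-1/k)) ≤ N^(1-k)` makes `W` small.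
* `S` lies in `Hᵏ⁺¹` on both sides of the node `1`, and `N⁻¹ ≤ N⁻¹ max |ψ'|` because `ψ` falls from
  `1` to `N⁻¹` on an interval of length `1 / 2`.

The interpolant of the continuous function `u` is continuous, so the cellwise derivative of the
error is its weak derivative on all of `(0, 2)`.
-/

noncomputable section

namespace CoarseMesh

/-! ### Weak derivatives -/

section WeakDerivative

variable {a b c : ℝ} {v g w η θ : ℝ → ℝ}

/-- Test functions on the open interval `(a, b)`. -/
structure IsTestFunction (a b : ℝ) (η : ℝ → ℝ) : Prop where
  contDiff : ContDiff ℝ ∞ η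
  hasCompactSupport : HasCompactSupport η
  tsupport_subset : tsupport η ⊆ Ioo a b

namespace IsTestFunction

lemma eq_zero (hη : IsTestFunction a b η) {x : ℝ} (hx : x ∉ Ioo a b) : η x = 0 :=
  image_eq_zero_of_notMem_tsupport fun h => hx (hη.tsupport_subset h)

lemma deriv (hη : IsTestFunction a b η) : IsTestFunction a b (deriv η) where
  contDiff := (contDiff_infty_iff_deriv.1 hη.contDiff).2
  hasCompactSupport := hη.hasCompactSupport.deriv
  tsupport_subset := tsupport_deriv_subset.trans hη.tsupport_subset

lemma sub_const_mul (hη : IsTestFunction a b η) (hθ : IsTestFunction a b θ) (s : ℝ) :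
    IsTestFunction a b (fun x => η x - s * θ x) := by
  have hsupp : tsupport (fun x => η x - s * θ x) ⊆ tsupport η ∪ tsupport θ := by
    refine closure_minimal (fun x hx => ?_) ((isClosed_tsupport η).union (isClosed_tsupport θ))
    by_contra hn
    rw [mem_union, not_or] at hn
    exact hx <| by
      simp [image_eq_zero_of_notMem_tsupport hn.1, image_eq_zero_of_notMem_tsupport hn.2]
  exact
    { contDiff := hη.contDiff.sub (contDiff_const.mul hθ.contDiff)
      hasCompactSupport := (hη.hasCompactSupport.isCompact.union
        hθ.hasCompactSupport.isCompact).of_isClosed_subset (isClosed_tsupport _) hsupp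
      tsupport_subset := hsupp.trans (union_subset hη.tsupport_subset hθ.tsupport_subset) }

lemma integrable (hη : IsTestFunction a b η) : Integrable η :=
  hη.contDiff.continuous.integrable_of_hasCompactSupport hη.hasCompactSupport

lemma integrable_mul (hη : IsTestFunction a b η) (hw : LocallyIntegrableOn w (Ioo a b)) :
    Integrable (fun x => w x * η x) := by
  have hsupp : IntegrableOn w (tsupport η) :=
    hw.integrableOn_compact_subset hη.tsupport_subset hη.hasCompactSupport
  refine (hsupp.mul_continuousOn hη.contDiff.continuous.continuousOn
    hη.hasCompactSupport).integrable_of_forall_notMem_eq_zero fun x hx => ?_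
  rw [image_eq_zero_of_notMem_tsupport hx, mul_zero]

lemma setIntegral_mul (hη : IsTestFunction a b η) (w : ℝ → ℝ) :
    ∫ x in Ioo a b, w x * η x = ∫ x, w x * η x :=
  setIntegral_eq_integral_of_forall_compl_eq_zero fun x hx => by rw [hη.eq_zero hx, mul_zero]

lemma exists_tsupport_subset_Icc (hη : IsTestFunction a b η) :
    ∃ a' b', a < a' ∧ b' < b ∧ tsupport η ⊆ Icc a' b' := by
  rcases (tsupport η).eq_empty_or_nonempty with hempty | hne
  · exact ⟨a + 1, b - 1, by linarith, by linarith, by simp [hempty]⟩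
  · obtain ⟨a', ha'⟩ := hη.hasCompactSupport.isCompact.exists_isLeast hne
    obtain ⟨b', hb'⟩ := hη.hasCompactSupport.isCompact.exists_isGreatest hne
    exact ⟨a', b', (hη.tsupport_subset ha'.1).1, (hη.tsupport_subset hb'.1).2,
      fun x hx => ⟨ha'.2 hx, hb'.2 hx⟩⟩

lemma exists_deriv_eq (hη : IsTestFunction a b η) (hzero : ∫ x, η x = 0) :
    ∃ ζ, IsTestFunction a b ζ ∧ _root_.deriv ζ = η := by
  obtain ⟨a', b', ha', hb', hsupp⟩ := hη.exists_tsupport_subset_Icc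
  have hηzero : ∀ {t}, t ∉ Icc a' b' → η t = 0 := fun ht =>
    image_eq_zero_of_notMem_tsupport fun h => ht (hsupp h)
  have hderiv : _root_.deriv (fun x => ∫ t in a..x, η t) = η :=
    funext fun x => hη.contDiff.continuous.deriv_integral η a x
  have hvanish : ∀ x ∉ Icc a' b', ∫ t in a..x, η t = 0 := by
    intro x hx
    rcases lt_or_ge x a' with hxa | hxa
    · refine intervalIntegral.integral_zero_ae (Eventually.of_forall fun t ht => ?_)
      exact hηzero fun h => (ht.2.trans_lt (max_lt ha' hxa)).not_ge h.1
    · have hxb : b' < x := not_le.1 fun h => hx ⟨hxa, h⟩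
      rw [intervalIntegral.integral_eq_integral_of_support_subset, hzero]
      intro t ht
      have ht' := hsupp (subset_tsupport _ ht)
      exact ⟨ha'.trans_le ht'.1, ht'.2.trans hxb.le⟩
  have hsupp' : tsupport (fun x => ∫ t in a..x, η t) ⊆ Icc a' b' :=
    closure_minimal (fun x hx => by_contra fun h => hx (hvanish x h)) isClosed_Icc
  refine ⟨fun x => ∫ t in a..x, η t, ⟨?_, ?_, ?_⟩, hderiv⟩
  · exact contDiff_infty_iff_deriv.2 ⟨fun x =>
      (hη.contDiff.continuous.integral_hasStrictDerivAt a x).hasDerivAt.differentiableAt,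
      by rw [hderiv]; exact hη.contDiff⟩
  · exact isCompact_Icc.of_isClosed_subset (isClosed_tsupport _) hsupp'
  · exact hsupp'.trans fun x hx => ⟨ha'.trans_le hx.1, hx.2.trans_lt hb'⟩

lemma exists_integral_eq_one (hab : a < b) : ∃ η, IsTestFunction a b η ∧ ∫ x, η x = 1 := by
  let bump : ContDiffBump ((a + b) / 2) :=
    ⟨(b - a) / 8, (b - a) / 4, by linarith, by linarith⟩
  refine ⟨bump.normed volume, ⟨bump.contDiff_normed, bump.hasCompactSupport_normed, ?_⟩,
    bump.integral_normed⟩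
  rw [bump.tsupport_normed_eq, Real.closedBall_eq_Icc,
    show bump.rOut = (b - a) / 4 from rfl]
  exact Icc_subset_Ioo (by linarith) (by linarith)

end IsTestFunction

/-- The lemma of du Bois-Reymond. -/
lemma ae_eq_const_of_integral_mul_deriv_eq_zero (hab : a < b)
    (hw : LocallyIntegrableOn w (Ioo a b))
    (hzero : ∀ η, IsTestFunction a b η → ∫ x in Ioo a b, w x * deriv η x = 0) :
    ∃ c, ∀ᵐ x, x ∈ Ioo a b → w x = c := by
  obtain ⟨η₀, hη₀, hη₀one⟩ := IsTestFunction.exists_integral_eq_one hab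
  set c := ∫ x, w x * η₀ x with hc
  have hae := isOpen_Ioo.ae_eq_zero_of_integral_contDiff_smul_eq_zero (μ := volume)
    (f := fun x => w x - c)
    (hw.sub (continuousOn_const.locallyIntegrableOn measurableSet_Ioo)) ?_
  · exact ⟨c, hae.mono fun x hx hx' => sub_eq_zero.1 (hx hx')⟩
  intro η hηc hηs hηt
  have hη : IsTestFunction a b η := ⟨hηc, hηs, hηt⟩
  -- Subtracting a multiple of `η₀` makes the integral vanish, so that a derivative is left.
  set s := ∫ x, η x with hs
  have hθ := hη.sub_const_mul hη₀ s
  obtain ⟨ζ, hζ, hζ'⟩ := hθ.exists_deriv_eq <| by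
    rw [integral_sub hη.integrable (hη₀.integrable.const_mul s), integral_const_mul, hη₀one,
      mul_one, sub_self]
  have horth : ∫ x, w x * η x - s * (w x * η₀ x) = 0 := by
    rw [← hzero ζ hζ, hζ', hθ.setIntegral_mul]
    exact integral_congr_ae (Eventually.of_forall fun x => by ring)
  rw [integral_sub (hη.integrable_mul hw) ((hη₀.integrable_mul hw).const_mul s),
    integral_const_mul, ← hc] at horth
  have hexpand : ∀ x, η x • (w x - c) = w x * η x - c * η x := fun x => by
    rw [smul_eq_mul]; ring
  simp_rw [hexpand]
  rw [integral_sub (hη.integrable_mul hw) (hη.integrable.const_mul c), integral_const_mul, ← hs]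
  linarith

namespace HasWeakDeriv

lemma of_eq_const_add_integral (hab : a < b) (hg : IntegrableOn g (Ioo a b))
    (hv : ∀ x ∈ Ioo a b, v x = c + ∫ t in a..x, g t) : HasWeakDeriv a b v g := by
  have hgi : IntervalIntegrable g volume a b :=
    (intervalIntegrable_iff_integrableOn_Ioo_of_le hab.le).2 hg
  have hac : AbsolutelyContinuousOnInterval (fun x => c + ∫ t in a..x, g t) a b :=
    ((LipschitzWith.const c).lipschitzOnWith).absolutelyContinuousOnInterval.add
      (hgi.absolutelyContinuousOnInterval_intervalIntegral (by simp))
  have hvc : ContinuousOn v (Ioo a b) :=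
    (hac.continuousOn.mono (Ioo_subset_Icc_self.trans Icc_subset_uIcc)).congr hv
  refine ⟨hvc.locallyIntegrableOn measurableSet_Ioo, hg.locallyIntegrableOn, ?_⟩
  intro η hηc hηs hηt
  have hη : IsTestFunction a b η := ⟨hηc, hηs, hηt⟩
  have hηac : AbsolutelyContinuousOnInterval η a b :=
    (hηc.of_le (by simp)).contDiffOn.absolutelyContinuousOnInterval
  have hparts : ∫ x in a..b, (c + ∫ t in a..x, g t) * deriv η x =
      -∫ x in a..b, deriv (fun x => c + ∫ t in a..x, g t) x * η x := by
    rw [hac.integral_mul_deriv_eq_deriv_mul hηac, hη.eq_zero right_notMem_Ioo,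
      hη.eq_zero left_notMem_Ioo]
    simp only [mul_zero, sub_zero, zero_sub]
  have hderiv : ∫ x in a..b, deriv (fun x => c + ∫ t in a..x, g t) x * η x =
      ∫ x in a..b, g x * η x := by
    refine intervalIntegral.integral_congr_ae ?_
    filter_upwards [hgi.ae_hasDerivAt_integral] with x hx hx'
    rw [((hx (uIoc_subset_uIcc hx') a (by simp)).const_add c).deriv]
  have hcongr : ∫ x in Ioo a b, v x * deriv η x =
      ∫ x in Ioo a b, (c + ∫ t in a..x, g t) * deriv η x :=
    setIntegral_congr_fun measurableSet_Ioo fun x hx => congrArg (· * deriv η x) (hv x hx)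
  rw [hcongr, ← integral_Ioc_eq_integral_Ioo, ← integral_Ioc_eq_integral_Ioo,
    ← intervalIntegral.integral_of_le hab.le, ← intervalIntegral.integral_of_le hab.le, hparts,
    hderiv]

lemma ae_eq_const_add_integral (hab : a < b) (h : HasWeakDeriv a b v g)
    (hg : IntegrableOn g (Ioo a b)) :
    ∃ c, ∀ᵐ x, x ∈ Ioo a b → v x = c + ∫ t in a..x, g t := by
  have hprim : HasWeakDeriv a b (fun x => ∫ t in a..x, g t) g :=
    of_eq_const_add_integral (c := 0) hab hg fun x _ => (zero_add _).symm
  obtain ⟨c, hc⟩ := ae_eq_const_of_integral_mul_deriv_eq_zero hab (h.1.sub hprim.1) <| by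
    intro η hη
    simp only [Pi.sub_apply, sub_mul]
    rw [integral_sub (hη.deriv.integrable_mul h.1).integrableOn
      (hη.deriv.integrable_mul hprim.1).integrableOn,
      h.2.2 η hη.contDiff hη.hasCompactSupport hη.tsupport_subset,
      hprim.2.2 η hη.contDiff hη.hasCompactSupport hη.tsupport_subset, sub_self]
  refine ⟨c, hc.mono fun x hx hx' => ?_⟩
  rw [← hx hx', Pi.sub_apply, sub_add_cancel]

end HasWeakDeriv

end WeakDerivative

/-! ### The `L²` norm -/

section L2norm

variable {v g : ℝ → ℝ} {D D' : Set ℝ}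

lemma L2norm_sq (v : ℝ → ℝ) (D : Set ℝ) : L2norm v D ^ 2 = ∫⁻ x in D, ‖v x‖ₑ ^ 2 := by
  simpa [L2norm] using
    eLpNorm_nnreal_pow_eq_lintegral (f := v) (μ := volume.restrict D) (p := 2) two_ne_zero

lemma L2norm_mono_ae (hD : MeasurableSet D) (h : ∀ᵐ x, x ∈ D → |v x| ≤ g x) :
    L2norm v D ≤ L2norm g D :=
  eLpNorm_mono_ae_real ((ae_restrict_iff' hD).2 h)

lemma L2norm_congr_ae (hD : MeasurableSet D) (h : ∀ᵐ x, x ∈ D → v x = g x) :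
    L2norm v D = L2norm g D :=
  eLpNorm_congr_ae ((ae_restrict_iff' hD).2 h)

lemma L2norm_congr (hD : MeasurableSet D) (h : EqOn v g D) : L2norm v D = L2norm g D :=
  L2norm_congr_ae hD (Eventually.of_forall h)

lemma L2norm_mono_set (h : D ⊆ D') : L2norm v D ≤ L2norm v D' :=
  eLpNorm_mono_measure v (Measure.restrict_mono h le_rfl)

lemma L2norm_abs_const_mul (c : ℝ) (v : ℝ → ℝ) (D : Set ℝ) :
    L2norm (fun x => |c * v x|) D = ENNReal.ofReal |c| * L2norm v D := by
  have h := eLpNorm_const_smul c v 2 (volume.restrict D)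
  rw [Real.enorm_eq_ofReal_abs, ← eLpNorm_norm] at h
  exact h

lemma L2norm_union_le (v : ℝ → ℝ) (D D' : Set ℝ) :
    L2norm v (D ∪ D') ≤ L2norm v D + L2norm v D' := by
  refine (ENNReal.pow_le_pow_left_iff two_ne_zero).1 ?_
  calc L2norm v (D ∪ D') ^ 2 ≤ L2norm v D ^ 2 + L2norm v D' ^ 2 := by
        simp_rw [L2norm_sq]
        exact lintegral_union_le _ _ _
    _ ≤ (L2norm v D + L2norm v D') ^ 2 := by
        rw [add_sq]
        gcongr
        exact le_self_add

lemma L2norm_add_le (hv : AEStronglyMeasurable v (volume.restrict D))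
    (hg : AEStronglyMeasurable g (volume.restrict D)) :
    L2norm (v + g) D ≤ L2norm v D + L2norm g D :=
  eLpNorm_add_le hv hg one_le_two

lemma L2norm_Ioo_le_of_abs_le {a b c : ℝ} (hc : 0 ≤ c) (hv : ∀ x ∈ Ioo a b, |v x| ≤ c) :
    L2norm v (Ioo a b) ≤ ENNReal.ofReal (c * √(b - a)) := by
  have h : L2norm v (Ioo a b) ≤
      volume.restrict (Ioo a b) univ ^ (2 : ℝ≥0∞).toReal⁻¹ * ENNReal.ofReal c :=
    eLpNorm_le_of_ae_bound ((ae_restrict_iff' measurableSet_Ioo).2 (Eventually.of_forall hv))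
  refine h.trans (le_of_eq ?_)
  rw [Measure.restrict_apply_univ, Real.volume_Ioo, mul_comm, ENNReal.ofReal_mul hc]
  congr 1
  rcases le_total a b with hab | hab
  · rw [Real.sqrt_eq_rpow, ← ENNReal.ofReal_rpow_of_nonneg (sub_nonneg.2 hab) (by norm_num)]
    norm_num
  · rw [Real.sqrt_eq_zero_of_nonpos (sub_nonpos.2 hab), ENNReal.ofReal_of_nonpos (sub_nonpos.2 hab),
      ENNReal.ofReal_zero]
    norm_num

lemma ofReal_integral_abs_le {f : ℝ → ℝ} {a b : ℝ} (hab : a ≤ b) (hf : IntegrableOn f (Ioo a b)) :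
    ENNReal.ofReal (∫ t in a..b, |f t|) ≤ ENNReal.ofReal √(b - a) * L2norm f (Ioo a b) := by
  have hone : ENNReal.ofReal (∫ t in a..b, |f t|) = eLpNorm f 1 (volume.restrict (Ioo a b)) := by
    rw [intervalIntegral.integral_of_le hab, integral_Ioc_eq_integral_Ioo,
      eLpNorm_one_eq_lintegral_enorm]
    exact ofReal_integral_norm_eq_lintegral_enorm hf
  rw [hone]
  refine (eLpNorm_le_eLpNorm_mul_rpow_measure_univ one_le_two hf.aestronglyMeasurable).trans
    (le_of_eq ?_)
  rw [mul_comm, L2norm, Measure.restrict_apply_univ, Real.volume_Ioo, Real.sqrt_eq_rpow,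
    ENNReal.ofReal_rpow_of_nonneg (sub_nonneg.2 hab) (by norm_num)]
  norm_num

lemma L2norm_Ioo_le_of_abs_le_integral {a b c : ℝ} {f : ℝ → ℝ} (hab : a ≤ b) (hc : 0 ≤ c)
    (hf : IntegrableOn f (Ioo a b)) (hv : ∀ x ∈ Ioo a b, |v x| ≤ c * ∫ t in a..b, |f t|) :
    L2norm v (Ioo a b) ≤ ENNReal.ofReal (c * (b - a)) * L2norm f (Ioo a b) := by
  have hint : 0 ≤ ∫ t in a..b, |f t| :=
    intervalIntegral.integral_nonneg hab fun _ _ => abs_nonneg _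
  calc L2norm v (Ioo a b) ≤ ENNReal.ofReal (c * (∫ t in a..b, |f t|) * √(b - a)) :=
        L2norm_Ioo_le_of_abs_le (by positivity) hv
    _ = ENNReal.ofReal (c * √(b - a)) * ENNReal.ofReal (∫ t in a..b, |f t|) := by
        rw [← ENNReal.ofReal_mul (by positivity), mul_right_comm]
    _ ≤ ENNReal.ofReal (c * √(b - a)) * (ENNReal.ofReal √(b - a) * L2norm f (Ioo a b)) := by
        gcongr
        exact ofReal_integral_abs_le hab hf
    _ = ENNReal.ofReal (c * (b - a)) * L2norm f (Ioo a b) := by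
        rw [← mul_assoc, ← ENNReal.ofReal_mul (by positivity), mul_assoc c,
          Real.mul_self_sqrt (sub_nonneg.2 hab)]

end L2norm

/-! ### Sobolev functions on an interval -/

/-- Functions in `W^{m,1}(a, b)` together with their weak derivatives, in their continuous
representatives on `[a, b]`: each of `F 0, …, F (m - 1)` is a primitive of the next function. -/
structure IsPrimitiveChain (a b : ℝ) (m : ℕ) (F : ℕ → ℝ → ℝ) : Prop where
  integrableOn : ∀ ℓ < m, IntegrableOn (F (ℓ + 1)) (Icc a b)
  sub_eq : ∀ ℓ < m, ∀ x ∈ Icc a b, ∀ y ∈ Icc a b, F ℓ y - F ℓ x = ∫ t in x..y, F (ℓ + 1) t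

/-- `D 0` is the continuous representative on `(a, b)` of a function in `W^{m,1}(a, b)`, and `D ℓ`
is its weak derivative of order `ℓ ≤ m`, up to null sets. The chain `F` supplies the limits of
`D 0` at the end points. -/
def IsSobolevJet (a b : ℝ) (m : ℕ) (D : ℕ → ℝ → ℝ) : Prop :=
  ∃ F : ℕ → ℝ → ℝ, IsPrimitiveChain a b m F ∧ EqOn (D 0) (F 0) (Ioo a b) ∧
    ∀ ℓ ≤ m, ∀ᵐ x, x ∈ Ioo a b → D ℓ x = F ℓ x

section SobolevJet

variable {a b a' b' : ℝ} {m m' ℓ : ℕ} {F G D D' : ℕ → ℝ → ℝ}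

namespace IsPrimitiveChain

lemma mono (h : IsPrimitiveChain a b m F) (ha : a ≤ a') (hb : b' ≤ b) (hm : m' ≤ m) :
    IsPrimitiveChain a' b' m' F :=
  have hsub : Icc a' b' ⊆ Icc a b := Icc_subset_Icc ha hb
  ⟨fun ℓ hℓ => (h.integrableOn ℓ (hℓ.trans_le hm)).mono_set hsub,
    fun ℓ hℓ x hx y hy => h.sub_eq ℓ (hℓ.trans_le hm) x (hsub hx) y (hsub hy)⟩

lemma intervalIntegrable (h : IsPrimitiveChain a b m F) (hℓ : ℓ < m) {x y : ℝ}
    (hx : x ∈ Icc a b) (hy : y ∈ Icc a b) : IntervalIntegrable (F (ℓ + 1)) volume x y :=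
  ((h.integrableOn ℓ hℓ).mono_set (uIcc_subset_Icc hx hy)).intervalIntegrable

lemma continuousOn (h : IsPrimitiveChain a b m F) (hℓ : ℓ < m) :
    ContinuousOn (F ℓ) (Icc a b) := by
  rcases lt_or_ge b a with hba | hab
  · simp [Icc_eq_empty hba.not_ge]
  have ha : a ∈ Icc a b := left_mem_Icc.2 hab
  have hprim := intervalIntegral.continuousOn_primitive_interval'
    (h.intervalIntegrable hℓ ha (right_mem_Icc.2 hab)) left_mem_uIcc
  rw [uIcc_of_le hab] at hprim
  refine (hprim.const_add (F ℓ a)).congr fun x hx => ?_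
  change F ℓ x = F ℓ a + ∫ t in a..x, F (ℓ + 1) t
  rw [← h.sub_eq ℓ hℓ a ha x hx, add_sub_cancel]

lemma add (hF : IsPrimitiveChain a b m F) (hG : IsPrimitiveChain a b m G) :
    IsPrimitiveChain a b m (fun ℓ => F ℓ + G ℓ) := by
  refine ⟨fun ℓ hℓ => (hF.integrableOn ℓ hℓ).add (hG.integrableOn ℓ hℓ), fun ℓ hℓ x hx y hy => ?_⟩
  simp only [Pi.add_apply]
  rw [intervalIntegral.integral_add (hF.intervalIntegrable hℓ hx hy)
    (hG.intervalIntegrable hℓ hx hy), ← hF.sub_eq ℓ hℓ x hx y hy, ← hG.sub_eq ℓ hℓ x hx y hy]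
  ring

lemma aestronglyMeasurable (h : IsPrimitiveChain a b (m + 1) F)
    (hℓ : ℓ ≤ m + 1) : AEStronglyMeasurable (F ℓ) (volume.restrict (Ioo a b)) := by
  rcases ℓ with _ | ℓ
  · exact ((h.continuousOn m.succ_pos).mono Ioo_subset_Icc_self).aestronglyMeasurable
      measurableSet_Ioo
  · exact ((h.integrableOn ℓ hℓ).mono_set Ioo_subset_Icc_self).aestronglyMeasurable

end IsPrimitiveChain

lemma exists_polynomial_iterate_derivative_eval_eq (m : ℕ) (a : ℝ) (c : ℕ → ℝ) :
    ∃ q : Polynomial ℝ, q.degree < (m + 1 : ℕ) ∧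
      ∀ j ≤ m, (Polynomial.derivative^[j] q).eval a = c j := by
  let p : Polynomial ℝ :=
    ∑ i ∈ Finset.range (m + 1), Polynomial.monomial i (c i / (i.factorial : ℝ))
  refine ⟨p.taylor (-a), ?_, fun j hj => ?_⟩
  · rw [Polynomial.degree_taylor, ← Polynomial.mem_degreeLT]
    refine Submodule.sum_mem _ fun i hi => Polynomial.mem_degreeLT.2 ?_
    exact (Polynomial.degree_monomial_le _ _).trans_lt (by exact_mod_cast Finset.mem_range.1 hi)
  · have hcoeff : (Polynomial.hasseDeriv j (p.taylor (-a))).eval a = c j / (j.factorial : ℝ) := by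
      rw [← Polynomial.taylor_coeff, Polynomial.taylor_taylor, add_neg_cancel,
        Polynomial.taylor_zero, Polynomial.finsetSum_coeff]
      simp only [Polynomial.coeff_monomial, Finset.sum_ite_eq', Finset.mem_range]
      rw [if_pos (Nat.lt_succ_of_le hj)]
    rw [← Polynomial.factorial_smul_hasseDeriv, LinearMap.smul_apply, Polynomial.eval_smul, hcoeff,
      nsmul_eq_mul, mul_div_cancel₀ _ (by exact_mod_cast j.factorial_ne_zero)]

lemma IsPrimitiveChain.exists_polynomial_abs_sub_le (hab : a ≤ b)
    (h : IsPrimitiveChain a b (m + 1) F) :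
    ∃ q : Polynomial ℝ, q.degree < (m + 1 : ℕ) ∧ ∀ j ≤ m, ∀ x ∈ Icc a b,
      |F j x - (Polynomial.derivative^[j] q).eval x| ≤
        (b - a) ^ (m - j) * ∫ t in a..b, |F (m + 1) t| := by
  obtain ⟨q, hq, hqa⟩ := exists_polynomial_iterate_derivative_eval_eq m a (fun j => F j a)
  have ha : a ∈ Icc a b := left_mem_Icc.2 hab
  have hremainder : ∀ j ≤ m, ∀ x ∈ Icc a b, F j x - (Polynomial.derivative^[j] q).eval x =
      ∫ t in a..x, F (j + 1) t - (Polynomial.derivative^[j + 1] q).eval t := by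
    intro j hj x hx
    rw [intervalIntegral.integral_sub (h.intervalIntegrable (by lia) ha hx)
      ((Polynomial.continuous _).intervalIntegrable _ _), ← h.sub_eq j (by lia) a ha x hx,
      Function.iterate_succ_apply',
      intervalIntegral.integral_eq_sub_of_hasDerivAt (fun t _ => Polynomial.hasDerivAt _ t)
        ((Polynomial.continuous _).intervalIntegrable _ _), hqa j hj]
    ring
  refine ⟨q, hq, fun j hj => ?_⟩
  induction hj using Nat.decreasingInduction with
  | self =>
    intro x hx
    rw [hremainder m le_rfl x hx, Polynomial.iterate_derivative_eq_zero_of_degree_lt hq,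
      Nat.sub_self, pow_zero, one_mul]
    simp only [Polynomial.eval_zero, sub_zero]
    refine (intervalIntegral.abs_integral_le_integral_abs hx.1).trans ?_
    exact intervalIntegral.integral_mono_interval le_rfl hx.1 hx.2
      (Eventually.of_forall fun t => abs_nonneg _)
      (h.intervalIntegrable (by lia) ha (right_mem_Icc.2 hab)).abs
  | of_succ j hj ih =>
    intro x hx
    have hT : 0 ≤ ∫ t in a..b, |F (m + 1) t| :=
      intervalIntegral.integral_nonneg hab fun _ _ => abs_nonneg _
    have hbound : ∀ t ∈ uIoc a x, ‖F (j + 1) t - (Polynomial.derivative^[j + 1] q).eval t‖ ≤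
        (b - a) ^ (m - (j + 1)) * ∫ t in a..b, |F (m + 1) t| := fun t ht =>
      have ht := uIoc_of_le hx.1 ▸ ht
      ih t ⟨ht.1.le, ht.2.trans hx.2⟩
    rw [hremainder j hj.le x hx]
    calc _ ≤ (b - a) ^ (m - (j + 1)) * (∫ t in a..b, |F (m + 1) t|) * |x - a| :=
          intervalIntegral.norm_integral_le_of_norm_le_const hbound
      _ ≤ (b - a) ^ (m - (j + 1)) * (∫ t in a..b, |F (m + 1) t|) * (b - a) := by
          have := sub_nonneg.2 hab
          rw [abs_of_nonneg (sub_nonneg.2 hx.1)]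
          gcongr
          exact hx.2
      _ = (b - a) ^ (m - j) * ∫ t in a..b, |F (m + 1) t| := by
          rw [show m - j = m - (j + 1) + 1 by lia, pow_succ]
          ring

namespace IsSobolevJet

lemma mono (h : IsSobolevJet a b m D) (ha : a ≤ a') (hb : b' ≤ b) (hm : m' ≤ m) :
    IsSobolevJet a' b' m' D := by
  obtain ⟨F, hF, hzero, hae⟩ := h
  have hsub : Ioo a' b' ⊆ Ioo a b := Ioo_subset_Ioo ha hb
  exact ⟨F, hF.mono ha hb hm, hzero.mono hsub, fun ℓ hℓ =>
    (hae ℓ (hℓ.trans hm)).mono fun x hx hx' => hx (hsub hx')⟩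

lemma add (h : IsSobolevJet a b m D) (h' : IsSobolevJet a b m D') :
    IsSobolevJet a b m (fun ℓ => D ℓ + D' ℓ) := by
  obtain ⟨F, hF, hzero, hae⟩ := h
  obtain ⟨F', hF', hzero', hae'⟩ := h'
  refine ⟨_, hF.add hF', fun x hx => congrArg₂ (· + ·) (hzero hx) (hzero' hx), fun ℓ hℓ => ?_⟩
  filter_upwards [hae ℓ hℓ, hae' ℓ hℓ] with x hx hx' hmem
  exact congrArg₂ (· + ·) (hx hmem) (hx' hmem)

lemma continuousOn (h : IsSobolevJet a b (m + 1) D) : ContinuousOn (D 0) (Ioo a b) := by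
  obtain ⟨F, hF, hzero, -⟩ := h
  exact ((hF.continuousOn m.succ_pos).mono Ioo_subset_Icc_self).congr hzero

lemma aestronglyMeasurable (h : IsSobolevJet a b (m + 1) D) (hℓ : ℓ ≤ m + 1) :
    AEStronglyMeasurable (D ℓ) (volume.restrict (Ioo a b)) := by
  obtain ⟨F, hF, -, hae⟩ := h
  refine (hF.aestronglyMeasurable hℓ).congr ?_
  exact (ae_restrict_iff' measurableSet_Ioo).2
    ((hae ℓ hℓ).mono fun x hx hx' => (hx hx').symm)

lemma integrableOn_one (h : IsSobolevJet a b (m + 1) D) :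
    IntegrableOn (D 1) (Ioo a b) := by
  obtain ⟨F, hF, -, hae⟩ := h
  refine ((hF.integrableOn 0 m.succ_pos).mono_set Ioo_subset_Icc_self).congr_fun_ae ?_
  exact (ae_restrict_iff' measurableSet_Ioo).2
    ((hae 1 (by lia)).mono fun x hx hx' => (hx hx').symm)

lemma sub_eq_integral (h : IsSobolevJet a b (m + 1) D) (hab : a < b)
    (hc : ContinuousOn (D 0) (Icc a b)) {y : ℝ} (hy : y ∈ Icc a b) :
    D 0 y - D 0 a = ∫ t in a..y, D 1 t := by
  obtain ⟨F, hF, hzero, hae⟩ := h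
  have hext : EqOn (D 0) (F 0) (Icc a b) := hzero.of_subset_closure hc
    (hF.continuousOn m.succ_pos) Ioo_subset_Icc_self (closure_Ioo hab.ne).ge
  have ha : a ∈ Icc a b := left_mem_Icc.2 hab.le
  rw [hext hy, hext ha, hF.sub_eq 0 m.succ_pos a ha y hy]
  refine intervalIntegral.integral_congr_ae ?_
  filter_upwards [hae 1 (by lia), compl_mem_ae_iff.2 (measure_singleton b)] with t ht htb hmem
  rw [uIoc_of_le hy.1] at hmem
  exact (ht ⟨hmem.1, lt_of_le_of_ne (hmem.2.trans hy.2) htb⟩).symm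

end IsSobolevJet

end SobolevJet

/-! ### Lagrange interpolation on one cell -/

/-- The reference interpolation points `0 = ξ_0 < … < ξ_k = 1` of `[0, 1]`, with a constant `Λ`
that bounds the Lebesgue constants of the interpolation operator and of all its derivatives. -/
structure IsReferenceGrid {k : ℕ} (ξ : Fin (k + 1) → ℝ) (Λ : ℝ) : Prop where
  strictMono : StrictMono ξ
  map_zero : ξ 0 = 0
  map_last : ξ (Fin.last k) = 1
  nonneg : 0 ≤ Λ
  abs_interpolate_le : ∀ (j : ℕ) (r : Fin (k + 1) → ℝ) (R : ℝ), (∀ i, |r i| ≤ R) →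
    ∀ s ∈ Icc (0 : ℝ) 1,
      |(Polynomial.derivative^[j] (Lagrange.interpolate Finset.univ ξ r)).eval s| ≤ Λ * R

/-- The Lagrange interpolation polynomial of `f` in the points `a + (b - a) ξ_j`. In contrast to
`cellInterp` it uses the values of `f`, not limits. -/
def cellPoly {k : ℕ} (ξ : Fin (k + 1) → ℝ) (a b : ℝ) (f : ℝ → ℝ) : Polynomial ℝ :=
  Lagrange.interpolate Finset.univ (fun j => a + (b - a) * ξ j) (fun j => f (a + (b - a) * ξ j))

lemma exists_abs_eval_iterate_derivative_le (p : Polynomial ℝ) :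
    ∃ c, ∀ j, ∀ s ∈ Icc (0 : ℝ) 1, |(Polynomial.derivative^[j] p).eval s| ≤ c := by
  have hbound : ∀ j, ∃ c, ∀ s ∈ Icc (0 : ℝ) 1, |(Polynomial.derivative^[j] p).eval s| ≤ c :=
    fun j => isCompact_Icc.exists_bound_of_continuousOn (Polynomial.continuous _).continuousOn
  choose c hc using hbound
  have hcnonneg : ∀ j, 0 ≤ c j := fun j => (abs_nonneg _).trans (hc j 0 (by simp))
  refine ⟨∑ j ∈ Finset.range (p.natDegree + 1), c j, fun j s hs => ?_⟩
  by_cases hj : j ≤ p.natDegree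
  · exact (hc j s hs).trans (Finset.single_le_sum (fun i _ => hcnonneg i)
      (Finset.mem_range.2 (Nat.lt_succ_of_le hj)))
  · rw [Polynomial.iterate_derivative_eq_zero (not_le.1 hj), Polynomial.eval_zero, abs_zero]
    exact Finset.sum_nonneg fun i _ => hcnonneg i

lemma iterate_derivative_comp_C_mul_X_sub_C (p : Polynomial ℝ) (a c : ℝ) (j : ℕ) :
    Polynomial.derivative^[j] (p.comp (Polynomial.C c * (Polynomial.X - Polynomial.C a))) =
      Polynomial.C (c ^ j) *
        (Polynomial.derivative^[j] p).comp (Polynomial.C c * (Polynomial.X - Polynomial.C a)) := by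
  induction j with
  | zero => simp
  | succ j ih =>
    rw [Function.iterate_succ_apply', Function.iterate_succ_apply', ih,
      Polynomial.derivative_C_mul, Polynomial.derivative_comp, Polynomial.derivative_C_mul,
      Polynomial.derivative_X_sub_C, mul_one, pow_succ, Polynomial.C_mul, mul_assoc]

section Cell

variable {k m : ℕ} {ξ : Fin (k + 1) → ℝ} {Λ a b R : ℝ} {f v : ℝ → ℝ} {F D D' : ℕ → ℝ → ℝ}

lemma cellPoly_sub (f g : ℝ → ℝ) :
    cellPoly ξ a b (f - g) = cellPoly ξ a b f - cellPoly ξ a b g :=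
  map_sub (Lagrange.interpolate Finset.univ fun j => a + (b - a) * ξ j) _ _

lemma cellPoly_add (f g : ℝ → ℝ) :
    cellPoly ξ a b (f + g) = cellPoly ξ a b f + cellPoly ξ a b g :=
  map_add (Lagrange.interpolate Finset.univ fun j => a + (b - a) * ξ j) _ _

namespace IsReferenceGrid

lemma exists_of_strictMono (hξ : StrictMono ξ) (hzero : ξ 0 = 0) (hlast : ξ (Fin.last k) = 1) :
    ∃ Λ, IsReferenceGrid ξ Λ := by
  choose c hc using exists_abs_eval_iterate_derivative_le
  let B : Fin (k + 1) → Polynomial ℝ := Lagrange.basis Finset.univ ξ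
  have hcnonneg : ∀ p, 0 ≤ c p := fun p => (abs_nonneg _).trans (hc p 0 0 (by simp))
  refine ⟨∑ i, c (B i), hξ, hzero, hlast, Finset.sum_nonneg fun i _ => hcnonneg _,
    fun j r R hR s hs => ?_⟩
  rw [Lagrange.interpolate_apply, Polynomial.iterate_derivative_sum, Polynomial.eval_finsetSum,
    Finset.sum_mul]
  refine (Finset.abs_sum_le_sum_abs _ _).trans (Finset.sum_le_sum fun i _ => ?_)
  rw [Polynomial.iterate_derivative_C_mul, Polynomial.eval_C_mul, abs_mul, mul_comm]
  gcongr
  · exact hcnonneg _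
  · exact hc (B i) j s hs
  · exact hR i

lemma point_mem_Icc (h : IsReferenceGrid ξ Λ) (hab : a ≤ b) (j : Fin (k + 1)) :
    a + (b - a) * ξ j ∈ Icc a b := by
  have hnonneg : 0 ≤ ξ j := h.map_zero ▸ h.strictMono.monotone (Fin.zero_le j)
  have hle_one : ξ j ≤ 1 := h.map_last ▸ h.strictMono.monotone (Fin.le_last j)
  constructor <;> nlinarith

lemma injOn_point (h : IsReferenceGrid ξ Λ) (hab : a < b) (s : Set (Fin (k + 1))) :
    InjOn (fun j => a + (b - a) * ξ j) s := fun _ _ _ _ hij =>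
  h.strictMono.injective (mul_left_cancel₀ (sub_pos.2 hab).ne' (add_left_cancel hij))

lemma cellInterp_eq_cellPoly (h : IsReferenceGrid ξ Λ) (hab : a < b) (hf : ContinuousOn f (Icc a b))
    (hv : EqOn v f (Ioo a b)) : cellInterp ξ a b v = cellPoly ξ a b f := by
  refine Lagrange.interpolate_eq_of_values_eq_on _ _ fun j _ => ?_
  have hmem := h.point_mem_Icc hab.le j
  refine extendFrom_eq (by rwa [closure_Ioo hab.ne]) ?_
  exact ((hf _ hmem).mono_left (nhdsWithin_mono _ Ioo_subset_Icc_self)).congr'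
    (eventually_nhdsWithin_of_forall fun x hx => (hv hx).symm)

lemma cellPoly_eval_point (h : IsReferenceGrid ξ Λ) (hab : a < b) (f : ℝ → ℝ) (j : Fin (k + 1)) :
    (cellPoly ξ a b f).eval (a + (b - a) * ξ j) = f (a + (b - a) * ξ j) :=
  Lagrange.eval_interpolate_at_node (fun j => f (a + (b - a) * ξ j)) (h.injOn_point hab _)
    (Finset.mem_univ j)

lemma cellPoly_eval_left (h : IsReferenceGrid ξ Λ) (hab : a < b) (f : ℝ → ℝ) :
    (cellPoly ξ a b f).eval a = f a := by
  simpa [h.map_zero] using h.cellPoly_eval_point hab f 0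

lemma cellPoly_eval_right (h : IsReferenceGrid ξ Λ) (hab : a < b) (f : ℝ → ℝ) :
    (cellPoly ξ a b f).eval b = f b := by
  simpa [h.map_last] using h.cellPoly_eval_point hab f (Fin.last k)

lemma cellPoly_eval_polynomial (h : IsReferenceGrid ξ Λ) (hab : a < b) {q : Polynomial ℝ}
    (hq : q.degree < (k + 1 : ℕ)) : cellPoly ξ a b (fun x => q.eval x) = q :=
  (Lagrange.eq_interpolate (h.injOn_point hab _) (by simpa using hq)).symm

lemma cellPoly_eq_comp (h : IsReferenceGrid ξ Λ) (hab : a < b) (f : ℝ → ℝ) :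
    cellPoly ξ a b f = (Lagrange.interpolate Finset.univ ξ fun j => f (a + (b - a) * ξ j)).comp
      (Polynomial.C (b - a)⁻¹ * (Polynomial.X - Polynomial.C a)) := by
  refine (Lagrange.eq_interpolate_of_eval_eq _ (h.injOn_point hab _) ?_ fun j _ => ?_).symm
  · rw [Finset.card_univ, Fintype.card_fin]
    have hξ : InjOn ξ (Finset.univ : Finset (Fin (k + 1))) := h.strictMono.injective.injOn
    have hdeg := Polynomial.natDegree_le_of_degree_le
      (Lagrange.degree_interpolate_le (fun j => f (a + (b - a) * ξ j)) hξ)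
    rw [Finset.card_univ, Fintype.card_fin, Nat.add_sub_cancel] at hdeg
    have hlin : (Polynomial.C (b - a)⁻¹ * (Polynomial.X - Polynomial.C a)).natDegree ≤ 1 :=
      (Polynomial.natDegree_C_mul_le _ _).trans (Polynomial.natDegree_X_sub_C a).le
    have hcomp := Polynomial.natDegree_comp_le.trans (Nat.mul_le_mul hdeg hlin)
    refine Polynomial.degree_le_natDegree.trans_lt ?_
    exact_mod_cast hcomp.trans_lt (by lia)
  · have hscale : (Polynomial.C (b - a)⁻¹ * (Polynomial.X - Polynomial.C a)).eval
        (a + (b - a) * ξ j) = ξ j := by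
      have := (sub_pos.2 hab).ne'
      simp [this]
    rw [Polynomial.eval_comp, hscale]
    exact Lagrange.eval_interpolate_at_node (fun j => f (a + (b - a) * ξ j))
      h.strictMono.injective.injOn (Finset.mem_univ j)

lemma abs_iterate_derivative_cellPoly_le (h : IsReferenceGrid ξ Λ) (hab : a < b)
    (hR : ∀ x ∈ Icc a b, |f x| ≤ R) (j : ℕ) {x : ℝ} (hx : x ∈ Icc a b) :
    |(Polynomial.derivative^[j] (cellPoly ξ a b f)).eval x| ≤ Λ * R * (b - a)⁻¹ ^ j := by
  have hba : 0 < b - a := sub_pos.2 hab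
  have hs : (b - a)⁻¹ * (x - a) ∈ Icc (0 : ℝ) 1 := by
    refine ⟨mul_nonneg (inv_nonneg.2 hba.le) (sub_nonneg.2 hx.1), ?_⟩
    rw [inv_mul_le_iff₀ hba]
    linarith [hx.2]
  have hbound := h.abs_interpolate_le j (fun i => f (a + (b - a) * ξ i)) R
    (fun i => hR _ (h.point_mem_Icc hab.le i)) _ hs
  rw [h.cellPoly_eq_comp hab, iterate_derivative_comp_C_mul_X_sub_C, Polynomial.eval_C_mul,
    Polynomial.eval_comp, abs_mul, abs_of_nonneg (by positivity), mul_comm]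
  gcongr
  simpa using hbound

lemma abs_sub_cellInterp_le (h : IsReferenceGrid ξ Λ) (hab : a < b) (hf : ContinuousOn f (Icc a b))
    (hv : EqOn v f (Ioo a b)) (hR : ∀ x ∈ Ioo a b, |v x| ≤ R) {x : ℝ} (hx : x ∈ Ioo a b) :
    |v x - (cellInterp ξ a b v).eval x| ≤ (1 + Λ) * R := by
  have hfR : ∀ y ∈ Icc a b, |f y| ≤ R := by
    rw [← closure_Ioo hab.ne] at hf ⊢
    exact le_on_closure (fun y hy => hv hy ▸ hR y hy) hf.abs continuousOn_const
  have hpoly := h.abs_iterate_derivative_cellPoly_le hab hfR 0 (Ioo_subset_Icc_self hx)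
  rw [pow_zero, mul_one] at hpoly
  rw [h.cellInterp_eq_cellPoly hab hf hv, one_add_mul]
  exact (abs_sub _ _).trans (add_le_add (hR x hx) hpoly)

lemma L2norm_sub_iterate_derivative_cellPoly_le (h : IsReferenceGrid ξ Λ) (hab : a < b)
    (hm : m ≤ k) (hF : IsPrimitiveChain a b (m + 1) F) {j : ℕ} (hj : j ≤ m + 1) :
    L2norm (F j - fun x => (Polynomial.derivative^[j] (cellPoly ξ a b (F 0))).eval x) (Ioo a b) ≤
      ENNReal.ofReal ((1 + Λ) * (b - a) ^ (m + 1 - j)) * L2norm (F (m + 1)) (Ioo a b) := by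
  have hΛ := h.nonneg
  have hba : 0 < b - a := sub_pos.2 hab
  have hint := (hF.integrableOn m m.lt_succ_self).mono_set Ioo_subset_Icc_self
  obtain ⟨q, hq, hFq⟩ := hF.exists_polynomial_abs_sub_le hab.le
  have htaylor : L2norm (F j - fun x => (Polynomial.derivative^[j] q).eval x) (Ioo a b) ≤
      ENNReal.ofReal ((b - a) ^ (m + 1 - j)) * L2norm (F (m + 1)) (Ioo a b) := by
    rcases Nat.le_succ_iff.1 hj with hj | rfl
    · rw [Nat.sub_add_comm hj, pow_succ]
      exact L2norm_Ioo_le_of_abs_le_integral hab.le (by positivity) hint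
        fun x hx => hFq j hj x (Ioo_subset_Icc_self hx)
    · rw [Polynomial.iterate_derivative_eq_zero_of_degree_lt hq]
      simp [Pi.sub_def]
  have hpoly : L2norm (fun x => (Polynomial.derivative^[j] q).eval x -
        (Polynomial.derivative^[j] (cellPoly ξ a b (F 0))).eval x) (Ioo a b) ≤
      ENNReal.ofReal (Λ * (b - a) ^ (m + 1 - j)) * L2norm (F (m + 1)) (Ioo a b) := by
    have hscale : Λ * (b - a) ^ (m + 1 - j) = Λ * (b - a)⁻¹ ^ j * (b - a) ^ m * (b - a) := by
      rw [mul_assoc _ _ (b - a), ← pow_succ, ← Nat.sub_add_cancel hj, pow_add,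
        Nat.add_sub_cancel, inv_pow]
      field_simp
    rw [hscale]
    refine L2norm_Ioo_le_of_abs_le_integral hab.le (by positivity) hint fun x hx => ?_
    have hstable := h.abs_iterate_derivative_cellPoly_le (f := F 0 - fun y => q.eval y) hab
      (hFq 0 m.zero_le) j (Ioo_subset_Icc_self hx)
    rw [cellPoly_sub, h.cellPoly_eval_polynomial hab (hq.trans_le (by exact_mod_cast by lia)),
      Polynomial.iterate_derivative_sub, Polynomial.eval_sub, abs_sub_comm] at hstable
    refine hstable.trans (le_of_eq ?_)
    rw [Nat.sub_zero]
    ring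
  rw [add_mul, one_mul, ENNReal.ofReal_add (by positivity) (by positivity), add_mul]
  refine le_trans ?_ (add_le_add htaylor hpoly)
  rw [← sub_add_sub_cancel (F j) (fun x => (Polynomial.derivative^[j] q).eval x)]
  exact L2norm_add_le
    ((hF.aestronglyMeasurable hj).sub (Polynomial.continuous _).aestronglyMeasurable)
    ((Polynomial.continuous _).sub (Polynomial.continuous _)).aestronglyMeasurable

lemma L2norm_sub_iterate_derivative_cellInterp_le (h : IsReferenceGrid ξ Λ) (hab : a < b)
    (hm : m ≤ k) (hD : IsSobolevJet a b (m + 1) D) {j : ℕ} (hj : j ≤ m + 1) :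
    L2norm (D j - fun x => (Polynomial.derivative^[j] (cellInterp ξ a b (D 0))).eval x)
        (Ioo a b) ≤
      ENNReal.ofReal ((1 + Λ) * (b - a) ^ (m + 1 - j)) * L2norm (D (m + 1)) (Ioo a b) := by
  obtain ⟨F, hF, hzero, hae⟩ := hD
  rw [h.cellInterp_eq_cellPoly hab (hF.continuousOn m.succ_pos) hzero,
    L2norm_congr_ae measurableSet_Ioo (hae (m + 1) le_rfl)]
  refine le_of_eq_of_le (L2norm_congr_ae measurableSet_Ioo ?_)
    (h.L2norm_sub_iterate_derivative_cellPoly_le hab hm hF hj)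
  filter_upwards [hae j hj] with x hx hmem
  exact congrArg (· - _) (hx hmem)

lemma cellInterp_add (h : IsReferenceGrid ξ Λ) (hab : a < b) (hD : IsSobolevJet a b (m + 1) D)
    (hD' : IsSobolevJet a b (m + 1) D') (hv : EqOn v (D 0 + D' 0) (Ioo a b)) :
    cellInterp ξ a b v = cellInterp ξ a b (D 0) + cellInterp ξ a b (D' 0) := by
  obtain ⟨F, hF, hzero, -⟩ := hD
  obtain ⟨F', hF', hzero', -⟩ := hD'
  have hc := hF.continuousOn m.succ_pos
  have hc' := hF'.continuousOn m.succ_pos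
  have hadd : EqOn v (F 0 + F' 0) (Ioo a b) :=
    fun x hx => (hv hx).trans (congrArg₂ (· + ·) (hzero hx) (hzero' hx))
  rw [h.cellInterp_eq_cellPoly hab hc hzero, h.cellInterp_eq_cellPoly hab hc' hzero',
    h.cellInterp_eq_cellPoly hab (hc.add hc') hadd, cellPoly_add]

lemma eval_cellInterp_eq_of_continuousOn (h : IsReferenceGrid ξ Λ) (hab : a < b)
    (hv : ContinuousOn v (Icc a b)) :
    (cellInterp ξ a b v).eval a = v a ∧ (cellInterp ξ a b v).eval b = v b := by
  rw [h.cellInterp_eq_cellPoly hab hv (eqOn_refl v _)]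
  exact ⟨h.cellPoly_eval_left hab v, h.cellPoly_eval_right hab v⟩

end IsReferenceGrid

end Cell

/-! ### Piecewise interpolation -/

/-- The piecewise derivative of order `j` of the interpolant `interp ξ N x v`. -/
def interpDeriv {k : ℕ} (ξ : Fin (k + 1) → ℝ) (N : ℕ) (x : ℕ → ℝ) (j : ℕ) (v : ℝ → ℝ) (y : ℝ) : ℝ :=
  ∑ i ∈ Finset.range N, (Ico (x i) (x (i + 1))).indicator
    (fun z => (Polynomial.derivative^[j] (cellInterp ξ (x i) (x (i + 1)) v)).eval z) y

section Mesh

variable {k m N i p q : ℕ} {ξ : Fin (k + 1) → ℝ} {Λ a b : ℝ} {x : ℕ → ℝ} {v g : ℝ → ℝ}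
  {D : ℕ → ℝ → ℝ}

lemma measurable_interpDeriv (ξ : Fin (k + 1) → ℝ) (N : ℕ) (x : ℕ → ℝ) (j : ℕ) (v : ℝ → ℝ) :
    Measurable (interpDeriv ξ N x j v) :=
  Finset.measurable_fun_sum _ fun _ _ =>
    (Polynomial.continuous _).measurable.indicator measurableSet_Ico

lemma interpDeriv_eqOn_cell (hx : Monotone x) (hi : i < N) (j : ℕ) (v : ℝ → ℝ) :
    EqOn (interpDeriv ξ N x j v)
      (fun y => (Polynomial.derivative^[j] (cellInterp ξ (x i) (x (i + 1)) v)).eval y)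
      (Ico (x i) (x (i + 1))) := by
  intro y hy
  refine (Finset.sum_eq_single i (fun l _ hl => ?_) fun h => ?_).trans (indicator_of_mem hy _)
  · exact indicator_of_notMem
      (disjoint_right.1 (hx.pairwise_disjoint_on_Ico_succ hl) hy) _
  · exact absurd (Finset.mem_range.2 hi) h

lemma interp_eqOn_cell (hx : Monotone x) (hi : i < N) (v : ℝ → ℝ) :
    EqOn (interp ξ N x v) (fun y => (cellInterp ξ (x i) (x (i + 1)) v).eval y)
      (Ico (x i) (x (i + 1))) :=
  interpDeriv_eqOn_cell hx hi 0 v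

lemma exists_mem_Ico_cell (hpq : p ≤ q) {y : ℝ} (hy : y ∈ Ico (x p) (x q)) :
    ∃ i, p ≤ i ∧ i < q ∧ y ∈ Ico (x i) (x (i + 1)) := by
  induction q, hpq using Nat.le_induction with
  | base => exact absurd (hy.1.trans_lt hy.2) (lt_irrefl _)
  | succ q hq ih =>
    by_cases h : y < x q
    · obtain ⟨i, hpi, hiq, hyi⟩ := ih ⟨hy.1, h⟩
      exact ⟨i, hpi, by lia, hyi⟩
    · exact ⟨q, hq, by lia, not_lt.1 h, hy.2⟩

lemma L2norm_Ico (v : ℝ → ℝ) (a b : ℝ) : L2norm v (Ico a b) = L2norm v (Ioo a b) := by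
  rw [L2norm, L2norm, Measure.restrict_congr_set Ioo_ae_eq_Ico]

lemma L2norm_Ioo_sq_add (v : ℝ → ℝ) {c : ℝ} (hab : a ≤ b) (hbc : b ≤ c) :
    L2norm v (Ioo a c) ^ 2 = L2norm v (Ioo a b) ^ 2 + L2norm v (Ioo b c) ^ 2 := by
  simp only [← L2norm_Ico, L2norm_sq]
  rw [← Ico_union_Ico_eq_Ico hab hbc]
  exact lintegral_union measurableSet_Ico
    ((Ico_disjoint_Ico_same (a := a) (b := b) (c := c)))

lemma L2norm_le_of_cells (hx : Monotone x) (hpq : p ≤ q) {c : ℝ≥0∞}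
    (h : ∀ i, p ≤ i → i < q →
      L2norm v (Ioo (x i) (x (i + 1))) ≤ c * L2norm g (Ioo (x i) (x (i + 1)))) :
    L2norm v (Ioo (x p) (x q)) ≤ c * L2norm g (Ioo (x p) (x q)) := by
  refine (ENNReal.pow_le_pow_left_iff two_ne_zero).1 ?_
  induction q, hpq using Nat.le_induction with
  | base => simp [L2norm]
  | succ q hpq ih =>
    have hcell := pow_le_pow_left' (h q hpq q.lt_succ_self) 2
    have ih := ih fun i hpi hiq => h i hpi (hiq.trans q.lt_succ_self)
    rw [mul_pow] at ih hcell ⊢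
    rw [L2norm_Ioo_sq_add v (hx hpq) (hx q.le_succ), L2norm_Ioo_sq_add g (hx hpq) (hx q.le_succ),
      mul_add]
    exact add_le_add ih hcell

lemma ae_ne_node (x : ℕ → ℝ) : ∀ᵐ y, ∀ i, y ≠ x i :=
  ae_all_iff.2 fun i => compl_mem_ae_iff.2 (measure_singleton (x i))

namespace IsReferenceGrid

theorem L2norm_sub_interpDeriv_le (h : IsReferenceGrid ξ Λ) (hx : Monotone x) (hpq : p ≤ q)
    (hq : q ≤ N) (hm : m ≤ k) (hD : IsSobolevJet (x p) (x q) (m + 1) D) {j : ℕ} (hj : j ≤ m + 1)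
    (hg : ∀ i, p ≤ i → i < q → ∀ y ∈ Ioo (x i) (x (i + 1)),
      (x (i + 1) - x i) ^ (m + 1 - j) * |D (m + 1) y| ≤ g y) :
    L2norm (D j - interpDeriv ξ N x j (D 0)) (Ioo (x p) (x q)) ≤
      ENNReal.ofReal (1 + Λ) * L2norm g (Ioo (x p) (x q)) := by
  have hΛ := h.nonneg
  refine L2norm_le_of_cells hx hpq fun i hpi hiq => ?_
  rcases (hx i.le_succ).eq_or_lt with hdeg | hab
  · simp [← hdeg, L2norm]
  have hwidth : 0 ≤ (x (i + 1) - x i) ^ (m + 1 - j) := pow_nonneg (sub_nonneg.2 hab.le) _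
  have hscale := L2norm_abs_const_mul ((x (i + 1) - x i) ^ (m + 1 - j)) (D (m + 1))
    (Ioo (x i) (x (i + 1)))
  rw [abs_of_nonneg hwidth] at hscale
  have hcell := h.L2norm_sub_iterate_derivative_cellInterp_le hab hm
    (hD.mono (hx hpi) (hx (Nat.succ_le_of_lt hiq)) le_rfl) hj
  have herr : EqOn (D j - interpDeriv ξ N x j (D 0)) (D j - fun y =>
      (Polynomial.derivative^[j] (cellInterp ξ (x i) (x (i + 1)) (D 0))).eval y)
      (Ioo (x i) (x (i + 1))) := fun y hy =>
    congrArg (D j y - ·) (interpDeriv_eqOn_cell hx (hiq.trans_le hq) j (D 0)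
      (Ioo_subset_Ico_self hy))
  rw [L2norm_congr measurableSet_Ioo herr]
  refine hcell.trans ?_
  rw [ENNReal.ofReal_mul (by positivity), mul_assoc, ← hscale]
  gcongr
  refine L2norm_mono_ae measurableSet_Ioo (Eventually.of_forall fun y hy => ?_)
  rw [abs_abs, abs_mul, abs_of_nonneg hwidth]
  exact hg i hpi hiq y hy

theorem L2norm_sub_interp_le_of_abs_le (h : IsReferenceGrid ξ Λ) (hx : Monotone x) (hpq : p ≤ q)
    (hq : q ≤ N) (hD : IsSobolevJet (x p) (x q) (m + 1) D) {R : ℝ}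
    (hR : ∀ y ∈ Ioo (x p) (x q), |D 0 y| ≤ R) :
    L2norm (D 0 - interp ξ N x (D 0)) (Ioo (x p) (x q)) ≤
      ENNReal.ofReal ((1 + Λ) * R * √(x q - x p)) := by
  rcases (hx hpq).eq_or_lt with hdeg | hlt
  · simp [hdeg, L2norm]
  obtain ⟨z, hz⟩ := exists_between hlt
  have hRnonneg : 0 ≤ R := (abs_nonneg _).trans (hR z hz)
  have hΛ := h.nonneg
  have hbound : ∀ᵐ y, y ∈ Ioo (x p) (x q) →
      |(D 0 - interp ξ N x (D 0)) y| ≤ (fun _ => (1 + Λ) * R) y := by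
    filter_upwards [ae_ne_node x] with y hnode hy
    obtain ⟨i, hpi, hiq, hyi⟩ := exists_mem_Ico_cell hpq (Ioo_subset_Ico_self hy)
    have hpx := hx hpi
    have hxq := hx (Nat.succ_le_of_lt hiq)
    obtain ⟨F, hF, hzero, -⟩ := hD.mono hpx hxq le_rfl
    rw [Pi.sub_apply, interp_eqOn_cell hx (hiq.trans_le hq) (D 0) hyi]
    exact h.abs_sub_cellInterp_le (hyi.1.trans_lt hyi.2) (hF.continuousOn m.succ_pos) hzero
      (fun z hz => hR z (Ioo_subset_Ioo hpx hxq hz)) ⟨hyi.1.lt_of_ne (hnode i).symm, hyi.2⟩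
  refine (L2norm_mono_ae measurableSet_Ioo hbound).trans
    (L2norm_Ioo_le_of_abs_le (by positivity) fun y _ => ?_)
  exact (abs_of_nonneg (by positivity)).le

lemma interpDeriv_add (h : IsReferenceGrid ξ Λ) (hx : Monotone x) {D' : ℕ → ℝ → ℝ}
    (hpq : p ≤ q) (hq : q ≤ N) (hD : IsSobolevJet (x p) (x q) (m + 1) D)
    (hD' : IsSobolevJet (x p) (x q) (m + 1) D') (hv : EqOn v (D 0 + D' 0) (Ioo (x p) (x q)))
    (j : ℕ) :
    EqOn (interpDeriv ξ N x j v)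
      (interpDeriv ξ N x j (D 0) + interpDeriv ξ N x j (D' 0)) (Ioo (x p) (x q)) := by
  intro y hy
  obtain ⟨i, hpi, hiq, hyi⟩ := exists_mem_Ico_cell hpq (Ioo_subset_Ico_self hy)
  have hpx := hx hpi
  have hxq := hx (Nat.succ_le_of_lt hiq)
  have hcell := fun w => interpDeriv_eqOn_cell (ξ := ξ) hx (hiq.trans_le hq) j w hyi
  rw [Pi.add_apply, hcell, hcell, hcell, h.cellInterp_add (hyi.1.trans_lt hyi.2)
    (hD.mono hpx hxq le_rfl) (hD'.mono hpx hxq le_rfl) (hv.mono (Ioo_subset_Ioo hpx hxq))]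
  simp only [iterate_map_add, Polynomial.eval_add]

lemma L2norm_sub_interpDeriv_le_add (h : IsReferenceGrid ξ Λ) (hx : Monotone x)
    {D' : ℕ → ℝ → ℝ} (hpq : p ≤ q) (hq : q ≤ N) (hD : IsSobolevJet (x p) (x q) (m + 1) D)
    (hD' : IsSobolevJet (x p) (x q) (m + 1) D') {j : ℕ} (hj : j ≤ m + 1)
    (hv : EqOn v (D 0 + D' 0) (Ioo (x p) (x q))) (hg : EqOn g (D j + D' j) (Ioo (x p) (x q))) :
    L2norm (g - interpDeriv ξ N x j v) (Ioo (x p) (x q)) ≤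
      L2norm (D j - interpDeriv ξ N x j (D 0)) (Ioo (x p) (x q)) +
        L2norm (D' j - interpDeriv ξ N x j (D' 0)) (Ioo (x p) (x q)) := by
  have hsplit : EqOn (g - interpDeriv ξ N x j v) ((D j - interpDeriv ξ N x j (D 0)) +
      (D' j - interpDeriv ξ N x j (D' 0))) (Ioo (x p) (x q)) := fun y hy => by
    have hadd := h.interpDeriv_add hx hpq hq hD hD' hv j hy
    have hgy := hg hy
    simp only [Pi.add_apply, Pi.sub_apply] at hadd hgy ⊢
    rw [hadd, hgy]
    ring
  rw [L2norm_congr measurableSet_Ioo hsplit]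
  exact L2norm_add_le
    ((hD.aestronglyMeasurable hj).sub (measurable_interpDeriv ξ N x j _).aestronglyMeasurable)
    ((hD'.aestronglyMeasurable hj).sub (measurable_interpDeriv ξ N x j _).aestronglyMeasurable)

end IsReferenceGrid

lemma HasWeakDeriv.of_cells (hx : Monotone x) (hlt : x 0 < x N)
    (hg : ∀ i < N, IntegrableOn g (Ioo (x i) (x (i + 1))))
    (hv : ∀ i < N, ∀ y ∈ Ico (x i) (x (i + 1)), v y = ∫ t in x i..y, g t)
    (hzero : ∀ i < N, ∫ t in x i..x (i + 1), g t = 0) :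
    HasWeakDeriv (x 0) (x N) v g := by
  have hcell : ∀ i < N, ∀ y ∈ Icc (x i) (x (i + 1)), IntervalIntegrable g volume (x i) y :=
    fun i hi y hy => ((intervalIntegrable_iff_integrableOn_Ioo_of_le (hx i.le_succ)).2
      (hg i hi)).mono_set (uIcc_subset_uIcc_left (uIcc_of_le (hx i.le_succ) ▸ hy))
  have hnodes : ∀ n ≤ N, IntervalIntegrable g volume (x 0) (x n) ∧ ∫ t in x 0..x n, g t = 0 := by
    intro n
    induction n with
    | zero => exact fun _ => ⟨IntervalIntegrable.refl, intervalIntegral.integral_same⟩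
    | succ n ih =>
      intro hn
      obtain ⟨hint, hsum⟩ := ih (Nat.le_of_succ_le hn)
      have hnext := hcell n hn _ (right_mem_Icc.2 (hx n.le_succ))
      refine ⟨hint.trans hnext, ?_⟩
      rw [← intervalIntegral.integral_add_adjacent_intervals hint hnext, hsum, hzero n hn, add_zero]
  have hall := (intervalIntegrable_iff_integrableOn_Ioo_of_le hlt.le).1 (hnodes N le_rfl).1
  refine .of_eq_const_add_integral (c := 0) hlt hall fun y hy => ?_
  obtain ⟨i, -, hi, hyi⟩ := exists_mem_Ico_cell N.zero_le (Ioo_subset_Ico_self hy)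
  obtain ⟨hint, hsum⟩ := hnodes i hi.le
  rw [← intervalIntegral.integral_add_adjacent_intervals hint
    (hcell i hi y (Ico_subset_Icc_self hyi)), hsum, hv i hi y hyi, zero_add, zero_add]

namespace IsReferenceGrid

lemma sub_eval_cellInterp_eq_integral (h : IsReferenceGrid ξ Λ) (hab : a < b)
    (hD : IsSobolevJet a b (m + 1) D) (hc : ContinuousOn (D 0) (Icc a b)) {y : ℝ}
    (hy : y ∈ Icc a b) :
    D 0 y - (cellInterp ξ a b (D 0)).eval y =
      ∫ t in a..y, D 1 t - (Polynomial.derivative (cellInterp ξ a b (D 0))).eval t := by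
  have hint : IntervalIntegrable (D 1) volume a y :=
    (intervalIntegrable_iff_integrableOn_Ioo_of_le hy.1).2
      (hD.integrableOn_one.mono_set (Ioo_subset_Ioo_right hy.2))
  have hpoly := (Polynomial.continuous (Polynomial.derivative
    (cellInterp ξ a b (D 0)))).intervalIntegrable (μ := volume) a y
  rw [intervalIntegral.integral_sub hint hpoly, ← hD.sub_eq_integral hab hc hy,
    intervalIntegral.integral_eq_sub_of_hasDerivAt (fun t _ => Polynomial.hasDerivAt _ t) hpoly,
    (h.eval_cellInterp_eq_of_continuousOn hab hc).1]
  ring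

theorem hasWeakDeriv_sub_interp (h : IsReferenceGrid ξ Λ) (hx : Monotone x) (hlt : x 0 < x N)
    (hD : ∀ i < N, IsSobolevJet (x i) (x (i + 1)) (m + 1) D)
    (hc : ContinuousOn (D 0) (Icc (x 0) (x N))) :
    HasWeakDeriv (x 0) (x N) (D 0 - interp ξ N x (D 0)) (D 1 - interpDeriv ξ N x 1 (D 0)) := by
  have hcell : ∀ i < N, ContinuousOn (D 0) (Icc (x i) (x (i + 1))) := fun i hi =>
    hc.mono (Icc_subset_Icc (hx i.zero_le) (hx (Nat.succ_le_of_lt hi)))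
  have heq : ∀ i < N, EqOn (D 1 - interpDeriv ξ N x 1 (D 0)) (fun t => D 1 t -
      (Polynomial.derivative (cellInterp ξ (x i) (x (i + 1)) (D 0))).eval t)
      (Ioo (x i) (x (i + 1))) := fun i hi t ht =>
    congrArg (D 1 t - ·) (interpDeriv_eqOn_cell hx hi 1 (D 0) (Ioo_subset_Ico_self ht))
  have hprim : ∀ i < N, x i < x (i + 1) → ∀ y ∈ Icc (x i) (x (i + 1)),
      D 0 y - (cellInterp ξ (x i) (x (i + 1)) (D 0)).eval y =
        ∫ t in x i..y, (D 1 - interpDeriv ξ N x 1 (D 0)) t := fun i hi hab y hy => by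
    rw [h.sub_eval_cellInterp_eq_integral hab (hD i hi) (hcell i hi) hy]
    exact (intervalIntegral.integral_congr_Ioo_of_le hy.1
      ((heq i hi).mono (Ioo_subset_Ioo_right hy.2))).symm
  refine .of_cells hx hlt (fun i hi => ?_) (fun i hi y hy => ?_) fun i hi => ?_
  · refine IntegrableOn.congr_fun ?_ (heq i hi).symm measurableSet_Ioo
    exact (hD i hi).integrableOn_one.sub
      ((Polynomial.continuous _).integrableOn_Icc.mono_set Ioo_subset_Icc_self)
  · rw [Pi.sub_apply, interp_eqOn_cell hx hi (D 0) hy]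
    exact hprim i hi (hy.1.trans_lt hy.2) y (Ico_subset_Icc_self hy)
  · rcases (hx i.le_succ).eq_or_lt with hdeg | hab
    · rw [← hdeg, intervalIntegral.integral_same]
    · rw [← hprim i hi hab _ (right_mem_Icc.2 hab.le),
        (h.eval_cellInterp_eq_of_continuousOn hab (hcell i hi)).2, sub_self]

end IsReferenceGrid

end Mesh

section Jets

variable {a b : ℝ} {m ℓ : ℕ} {v u g : ℝ → ℝ} {D : ℕ → ℝ → ℝ}

namespace IsSobolevJet

lemma update_zero (h : IsSobolevJet a b m D) (hu : EqOn u (D 0) (Ioo a b)) :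
    IsSobolevJet a b m (Function.update D 0 u) := by
  obtain ⟨F, hF, hzero, hae⟩ := h
  refine ⟨F, hF, ?_, fun ℓ hℓ => ?_⟩
  · rw [Function.update_self]
    exact hu.trans hzero
  · rcases eq_or_ne ℓ 0 with rfl | hℓ0
    · rw [Function.update_self]
      exact Eventually.of_forall (hu.trans hzero)
    · rw [Function.update_of_ne hℓ0]
      exact hae ℓ hℓ

theorem of_ae_eq_const_add_integral (hab : a < b) (hc : ContinuousOn (D 0) (Ioo a b))
    (hint : ∀ ℓ < m + 1, IntegrableOn (D (ℓ + 1)) (Ioo a b))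
    (hprim : ∀ ℓ < m + 1, ∃ c, ∀ᵐ x, x ∈ Ioo a b → D ℓ x = c + ∫ t in a..x, D (ℓ + 1) t) :
    IsSobolevJet a b (m + 1) D := by
  choose! c hc' using hprim
  let F : ℕ → ℝ → ℝ := fun ℓ x => if ℓ < m + 1 then c ℓ + ∫ t in a..x, D (ℓ + 1) t else D ℓ x
  have hDF : ∀ ℓ, ∀ᵐ x, x ∈ Ioo a b → D ℓ x = F ℓ x := fun ℓ => by
    by_cases hℓ : ℓ < m + 1
    · simpa only [F, if_pos hℓ] using hc' ℓ hℓ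
    · exact Eventually.of_forall fun x _ => (if_neg hℓ).symm
  have hDF' : ∀ ℓ, D ℓ =ᵐ[volume.restrict (Icc a b)] F ℓ := fun ℓ => by
    rw [Measure.restrict_congr_set Ioo_ae_eq_Icc.symm]
    exact (ae_restrict_iff' measurableSet_Ioo).2 (hDF ℓ)
  have hint' : ∀ ℓ < m + 1, IntegrableOn (D (ℓ + 1)) (Icc a b) := fun ℓ hℓ =>
    (integrableOn_Icc_iff_integrableOn_Ioo).2 (hint ℓ hℓ)
  have hchain : IsPrimitiveChain a b (m + 1) F := by
    refine ⟨fun ℓ hℓ => (hint' ℓ hℓ).congr_fun_ae (hDF' _), fun ℓ hℓ x hx y hy => ?_⟩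
    have hsub : uIoc x y ⊆ Icc a b := uIoc_subset_uIcc.trans (uIcc_subset_Icc hx hy)
    have hii : ∀ {s t}, s ∈ Icc a b → t ∈ Icc a b → IntervalIntegrable (D (ℓ + 1)) volume s t :=
      fun hs ht => ((hint' ℓ hℓ).mono_set (uIcc_subset_Icc hs ht)).intervalIntegrable
    rw [← intervalIntegral.integral_congr_ae_restrict (ae_restrict_of_ae_restrict_of_subset hsub
      (hDF' (ℓ + 1))), ← intervalIntegral.integral_interval_sub_left
      (hii (left_mem_Icc.2 hab.le) hy) (hii (left_mem_Icc.2 hab.le) hx)]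
    simp only [F, if_pos hℓ]
    ring
  refine ⟨F, hchain, ?_, fun ℓ _ => hDF ℓ⟩
  exact Measure.eqOn_open_of_ae_eq (μ := volume)
    ((ae_restrict_iff' measurableSet_Ioo).2 (hDF 0)) isOpen_Ioo hc
    ((hchain.continuousOn m.succ_pos).mono Ioo_subset_Icc_self)

end IsSobolevJet

lemma HasWeakDeriv.integrableOn (h : HasWeakDeriv a b v g) (hg : L2norm g (Ioo a b) < ⊤) :
    IntegrableOn g (Ioo a b) :=
  MemLp.integrable one_le_two ⟨h.2.1.aestronglyMeasurable, hg⟩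

lemma IsSobolevJet.of_hasWeakDeriv (hab : a < b) (hc : ContinuousOn (D 0) (Ioo a b))
    (hD : ∀ ℓ < m + 1, HasWeakDeriv a b (D ℓ) (D (ℓ + 1)))
    (hfin : ∀ ℓ < m + 1, L2norm (D (ℓ + 1)) (Ioo a b) < ⊤) : IsSobolevJet a b (m + 1) D :=
  have hint := fun ℓ hℓ => (hD ℓ hℓ).integrableOn (hfin ℓ hℓ)
  .of_ae_eq_const_add_integral hab hc hint fun ℓ hℓ =>
    (hD ℓ hℓ).ae_eq_const_add_integral hab (hint ℓ hℓ)

lemma BrokenSobolevBound.exists_isSobolevJet {K : ℝ} (h : BrokenSobolevBound (m + 1) K v) :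
    ∃ D : ℕ → ℝ → ℝ, D 0 = v ∧ IsSobolevJet 0 1 (m + 1) D ∧ IsSobolevJet 1 2 (m + 1) D ∧
      ∀ ℓ ≤ m + 1, L2norm (D ℓ) (Ioo 0 1) + L2norm (D ℓ) (Ioo 1 2) ≤ ENNReal.ofReal K := by
  obtain ⟨hleft, hright, D, rfl, hD, hbound⟩ := h
  refine ⟨D, rfl, ?_, ?_, hbound⟩
  · exact .of_hasWeakDeriv zero_lt_one hleft (fun ℓ hℓ => (hD ℓ hℓ).1) fun ℓ hℓ =>
      (le_self_add.trans (hbound (ℓ + 1) hℓ)).trans_lt ENNReal.ofReal_lt_top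
  · exact .of_hasWeakDeriv one_lt_two hright (fun ℓ hℓ => (hD ℓ hℓ).2) fun ℓ hℓ =>
      (le_add_self.trans (hbound (ℓ + 1) hℓ)).trans_lt ENNReal.ofReal_lt_top

lemma continuousOn_iteratedDeriv (hv : ContDiffOn ℝ m v (Ioo a b)) (hℓ : ℓ ≤ m) :
    ContinuousOn (iteratedDeriv ℓ v) (Ioo a b) :=
  (hv.continuousOn_iteratedDerivWithin (by exact_mod_cast hℓ) isOpen_Ioo.uniqueDiffOn).congr
    fun _ hx => (iteratedDerivWithin_of_isOpen isOpen_Ioo hx).symm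

lemma hasDerivAt_iteratedDeriv (hv : ContDiffOn ℝ m v (Ioo a b)) (hℓ : ℓ < m) {x : ℝ}
    (hx : x ∈ Ioo a b) : HasDerivAt (iteratedDeriv ℓ v) (iteratedDeriv (ℓ + 1) v x) x := by
  have hdiff := (hv.differentiableOn_iteratedDerivWithin (m := ℓ) (by exact_mod_cast hℓ)
    isOpen_Ioo.uniqueDiffOn).congr (f₁ := iteratedDeriv ℓ v)
    (fun _ hx => (iteratedDerivWithin_of_isOpen isOpen_Ioo hx).symm)
  rw [iteratedDeriv_succ]
  exact ((hdiff x hx).differentiableAt (isOpen_Ioo.mem_nhds hx)).hasDerivAt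

lemma exists_eq_const_add_integral_of_hasDerivAt (hab : a < b)
    (hv : ∀ x ∈ Ioo a b, HasDerivAt v (g x) x) (hg : IntegrableOn g (Ioo a b)) :
    ∃ c, ∀ x ∈ Ioo a b, v x = c + ∫ t in a..x, g t := by
  obtain ⟨z, hz⟩ := exists_between hab
  have hii : ∀ {s t}, s ∈ Icc a b → t ∈ Icc a b → IntervalIntegrable g volume s t := fun hs ht =>
    (((integrableOn_Icc_iff_integrableOn_Ioo).2 hg).mono_set
      (uIcc_subset_Icc hs ht)).intervalIntegrable
  have ha : a ∈ Icc a b := left_mem_Icc.2 hab.le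
  have hzc := Ioo_subset_Icc_self hz
  refine ⟨v z - ∫ t in a..z, g t, fun x hx => ?_⟩
  have hxc := Ioo_subset_Icc_self hx
  have hftc : ∫ t in z..x, g t = v x - v z := intervalIntegral.integral_eq_sub_of_hasDerivAt
    (fun t ht => hv t (ordConnected_Ioo.uIcc_subset hz hx ht)) (hii hzc hxc)
  rw [← intervalIntegral.integral_add_adjacent_intervals (hii ha hzc) (hii hzc hxc), hftc]
  ring

lemma IsSobolevJet.of_contDiffOn (hab : a < b) (hv : ContDiffOn ℝ (m + 1 : ℕ) v (Ioo a b))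
    (hbdd : ∀ ℓ ≤ m + 1, ∃ B, ∀ x ∈ Ioo a b, |iteratedDeriv ℓ v x| ≤ B) :
    IsSobolevJet a b (m + 1) (fun ℓ => iteratedDeriv ℓ v) := by
  have hint : ∀ ℓ < m + 1, IntegrableOn (iteratedDeriv (ℓ + 1) v) (Ioo a b) := fun ℓ hℓ => by
    obtain ⟨B, hB⟩ := hbdd (ℓ + 1) hℓ
    exact .of_bound measure_Ioo_lt_top
      ((continuousOn_iteratedDeriv hv hℓ).aestronglyMeasurable measurableSet_Ioo) B
      ((ae_restrict_iff' measurableSet_Ioo).2 (Eventually.of_forall hB))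
  refine .of_ae_eq_const_add_integral hab (continuousOn_iteratedDeriv hv (Nat.zero_le _)) hint
    fun ℓ hℓ => ?_
  obtain ⟨c, hc⟩ := exists_eq_const_add_integral_of_hasDerivAt hab
    (fun x hx => hasDerivAt_iteratedDeriv hv hℓ hx) (hint ℓ hℓ)
  exact ⟨c, Eventually.of_forall hc⟩

lemma iteratedDeriv_eqOn_zero {U : Set ℝ} (hU : IsOpen U) (hv : EqOn v 0 U) (ℓ : ℕ) :
    EqOn (iteratedDeriv ℓ v) 0 U := fun x hx => by
  have h : v =ᶠ[𝓝 x] fun _ => 0 := hv.eventuallyEq_of_mem (hU.mem_nhds hx)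
  rw [h.iteratedDeriv_eq, iteratedDeriv_fun_const_zero, Pi.zero_apply]

end Jets

/-! ### Mesh widths -/

section Mesh

variable {k n : ℕ} {β σ ε : ℝ} {φ : ℝ → ℝ}

lemma node_of_le {i : ℕ} (hi : i ≤ n) :
    node k β σ ε (4 * n) φ i = σ * ε / β * φ (2 * i / (4 * n : ℕ)) := by
  rw [node, if_pos (by lia)]

lemma node_zero (hφ : IsMeshFunction (4 * n) φ) : node k β σ ε (4 * n) φ 0 = 0 := by
  rw [node_of_le (Nat.zero_le n), Nat.cast_zero, mul_zero, zero_div, hφ.map_zero, mul_zero]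

lemma node_eq_lam (hn : 0 < n) (hφ : IsMeshFunction (4 * n) φ) :
    node k β σ ε (4 * n) φ n = lam β σ ε (4 * n) := by
  have h_half : 2 * (n : ℝ) / (4 * n : ℕ) = 1 / 2 := by
    push_cast
    field_simp
    norm_num
  rw [node_of_le le_rfl, h_half, hφ.map_half, lam]

lemma node_of_le_of_le_two_mul (hn : 0 < n) (hφ : IsMeshFunction (4 * n) φ) {i : ℕ} (h₁ : n ≤ i)
    (h₂ : i ≤ 2 * n) : node k β σ ε (4 * n) φ i =
      i / n * (1 - lam β σ ε (4 * n)) + 2 * lam β σ ε (4 * n) - 1 := by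
  rcases h₁.eq_or_lt with rfl | h₁
  · rw [node_eq_lam hn hφ]
    field_simp
    ring
  · rw [node, if_neg (by lia), if_pos (by lia)]
    push_cast
    field_simp

lemma node_two_mul (hn : 0 < n) (hφ : IsMeshFunction (4 * n) φ) :
    node k β σ ε (4 * n) φ (2 * n) = 1 := by
  rw [node_of_le_of_le_two_mul hn hφ (by lia) le_rfl]
  push_cast
  field_simp
  ring

lemma node_of_two_mul_le (hn : 0 < n) (hφ : IsMeshFunction (4 * n) φ) {i : ℕ} (h₁ : 2 * n ≤ i)
    (h₂ : i ≤ 3 * n) : node k β σ ε (4 * n) φ i = 1 + mu k β ε * (i / n - 2) := by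
  rcases h₁.eq_or_lt with rfl | h₁
  · rw [node_two_mul hn hφ]
    push_cast
    field_simp
    ring
  · rw [node, if_neg (by lia), if_neg (by lia), if_pos (by lia)]
    push_cast
    field_simp

lemma node_three_mul (hn : 0 < n) (hφ : IsMeshFunction (4 * n) φ) :
    node k β σ ε (4 * n) φ (3 * n) = 1 + mu k β ε := by
  rw [node_of_two_mul_le hn hφ (by lia) le_rfl]
  push_cast
  field_simp
  ring

lemma node_of_three_mul_le (hn : 0 < n) (hφ : IsMeshFunction (4 * n) φ) {i : ℕ}
    (h₁ : 3 * n ≤ i) :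
    node k β σ ε (4 * n) φ i = i / n * (1 - mu k β ε) + 4 * mu k β ε - 2 := by
  rcases h₁.eq_or_lt with rfl | h₁
  · rw [node_three_mul hn hφ]
    push_cast
    field_simp
    ring
  · rw [node, if_neg (by lia), if_neg (by lia), if_neg (by lia)]
    push_cast
    field_simp

lemma node_four_mul (hn : 0 < n) (hφ : IsMeshFunction (4 * n) φ) :
    node k β σ ε (4 * n) φ (4 * n) = 2 := by
  rw [node_of_three_mul_le hn hφ (by lia)]
  push_cast
  field_simp
  ring

lemma node_succ_sub_node_of_le (hn : 0 < n) (hφ : IsMeshFunction (4 * n) φ) {i : ℕ}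
    (h₁ : n ≤ i) (h₂ : i < 2 * n) :
    node k β σ ε (4 * n) φ (i + 1) - node k β σ ε (4 * n) φ i =
      (1 - lam β σ ε (4 * n)) / n := by
  rw [node_of_le_of_le_two_mul hn hφ h₁ h₂.le, node_of_le_of_le_two_mul hn hφ (by lia) h₂]
  push_cast
  ring

lemma node_succ_sub_node_of_two_mul_le (hn : 0 < n) (hφ : IsMeshFunction (4 * n) φ) {i : ℕ}
    (h₁ : 2 * n ≤ i) (h₂ : i < 3 * n) :
    node k β σ ε (4 * n) φ (i + 1) - node k β σ ε (4 * n) φ i = mu k β ε / n := by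
  rw [node_of_two_mul_le hn hφ h₁ h₂.le, node_of_two_mul_le hn hφ (by lia) h₂]
  push_cast
  ring

lemma node_succ_sub_node_of_three_mul_le (hn : 0 < n) (hφ : IsMeshFunction (4 * n) φ) {i : ℕ}
    (h₁ : 3 * n ≤ i) :
    node k β σ ε (4 * n) φ (i + 1) - node k β σ ε (4 * n) φ i = (1 - mu k β ε) / n := by
  rw [node_of_three_mul_le hn hφ h₁, node_of_three_mul_le hn hφ (by lia)]
  push_cast
  ring

lemma two_mul_div_mem_Icc {i : ℕ} (hi : i ≤ n) :
    2 * (i : ℝ) / (4 * n : ℕ) ∈ Icc (0 : ℝ) (1 / 2) := by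
  refine ⟨by positivity, div_le_of_le_mul₀ (by positivity) (by norm_num) ?_⟩
  have : (i : ℝ) ≤ n := by exact_mod_cast hi
  push_cast
  linarith

lemma node_le_node_succ_of_lt (hβ : 0 < β) (hσ : 0 < σ) (hε : 0 < ε)
    (hφ : IsMeshFunction (4 * n) φ) {i : ℕ} (hi : i < n) :
    node k β σ ε (4 * n) φ i ≤ node k β σ ε (4 * n) φ (i + 1) := by
  rw [node_of_le hi.le, node_of_le hi]
  have hφ_le := hφ.monotoneOn (two_mul_div_mem_Icc hi.le) (two_mul_div_mem_Icc hi)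
    (by gcongr; lia)
  gcongr

lemma node_succ_sub_node_le_h₁ {i : ℕ} (hi : i < n) :
    node k β σ ε (4 * n) φ (i + 1) - node k β σ ε (4 * n) φ i ≤ h₁ k β σ ε (4 * n) φ :=
  le_ciSup (f := fun i : Fin (4 * n / 4) =>
    node k β σ ε (4 * n) φ (i + 1) - node k β σ ε (4 * n) φ i) (Set.finite_range _).bddAbove
    ⟨i, by lia⟩

end Mesh

namespace IsMeshFunction

variable {N : ℕ} {φ : ℝ → ℝ}

lemma abs_deriv_psi_le (hφ : IsMeshFunction N φ) {t : ℝ} (ht : t ∈ Ioo (0 : ℝ) (1 / 2)) :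
    |deriv (psi φ) t| ≤ maxAbsDerivPsi φ :=
  le_csSup hφ.bddAbove (mem_image_of_mem _ ht)

lemma psi_sub_le (hφ : IsMeshFunction N φ) {s t : ℝ} (hs : 0 ≤ s) (hst : s ≤ t)
    (ht : t ≤ 1 / 2) : psi φ s - psi φ t ≤ maxAbsDerivPsi φ * (t - s) := by
  obtain ⟨P, hP⟩ := hφ.differentiableAt
  have hsub : Ioo s t ⊆ Ioo 0 (1 / 2) := Ioo_subset_Ioo hs ht
  have hcont : ContinuousOn (psi φ) (Icc s t) :=
    (hφ.continuousOn.mono (Icc_subset_Icc hs ht)).neg.rexp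
  have hint : IntervalIntegrable (deriv (psi φ)) volume s t := by
    rw [intervalIntegrable_iff_integrableOn_Ioo_of_le hst]
    exact Measure.integrableOn_of_bounded measure_Ioo_lt_top.ne
      (measurable_deriv _).aestronglyMeasurable
      (ae_restrict_of_forall_mem measurableSet_Ioo fun x hx => hφ.abs_deriv_psi_le (hsub hx))
  have hftc := integral_eq_of_hasDerivAt_off_countable_of_le (psi φ) (deriv (psi φ)) hst
    P.countable_toSet hcont
    (fun x hx => (hP x (hsub hx.1) hx.2).neg.exp.hasDerivAt) hint
  have hbound : ∀ᵐ x, x ∈ uIoc s t → ‖deriv (psi φ) x‖ ≤ maxAbsDerivPsi φ := by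
    filter_upwards [Measure.ae_ne volume t] with x hxt hx
    rw [uIoc_of_le hst] at hx
    exact hφ.abs_deriv_psi_le (hsub ⟨hx.1, hx.2.lt_of_ne hxt⟩)
  have hnorm := intervalIntegral.norm_integral_le_of_norm_le_const_ae hbound
  rw [hftc, Real.norm_eq_abs, abs_of_nonneg (sub_nonneg.2 hst)] at hnorm
  linarith [(abs_le.1 hnorm).1]

lemma one_le_maxAbsDerivPsi (hφ : IsMeshFunction N φ) (hN : 2 ≤ N) :
    1 ≤ maxAbsDerivPsi φ := by
  have hψ := hφ.psi_sub_le le_rfl (by norm_num : (0 : ℝ) ≤ 1 / 2) le_rfl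
  have hN' : (2 : ℝ) ≤ N := by exact_mod_cast hN
  have hinv : (N : ℝ)⁻¹ ≤ 2⁻¹ := by gcongr
  rw [psi, psi, hφ.map_zero, hφ.map_half, Real.exp_neg (Real.log _),
    Real.exp_log (by linarith), neg_zero, Real.exp_zero] at hψ
  linarith

/-- Since `z ≤ exp z - 1`, an increment of `φ` is controlled by one of `ψ`, at the price of the
factor `exp φ` that the decay of the layer function absorbs. -/
lemma sub_le_exp_mul (hφ : IsMeshFunction N φ) {s t : ℝ} (hs : 0 ≤ s) (hst : s ≤ t)
    (ht : t ≤ 1 / 2) : φ t - φ s ≤ Real.exp (φ t) * (maxAbsDerivPsi φ * (t - s)) :=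
  calc φ t - φ s ≤ Real.exp (φ t - φ s) - 1 := by linarith [Real.add_one_le_exp (φ t - φ s)]
    _ = Real.exp (φ t) * (psi φ s - psi φ t) := by
      rw [psi, psi, mul_sub, ← Real.exp_add, ← Real.exp_add, ← sub_eq_add_neg, add_neg_cancel,
        Real.exp_zero]
    _ ≤ Real.exp (φ t) * (maxAbsDerivPsi φ * (t - s)) := by
      gcongr
      exact hφ.psi_sub_le hs hst ht

end IsMeshFunction

/-- The factor in the bound `x_i - x_{i-1} ≤ layerWidthConst · ε N⁻¹ max|ψ'| exp (β y / (σ ε))` for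
the cells of the strong layer region. -/
def layerWidthConst (β σ K₁ : ℝ) : ℝ := 2 * σ / β * Real.exp (β * K₁ / σ)

/-- The standing assumptions on the mesh with `N = 4 n` cells: the parameters are in the admissible
range, both transition points are at most `1/2`, the mesh is fine in the strong layer region
(`h₁ ≤ K₁ ε`) and `N` is small enough for the weak layer (`exp (-ε^{-1/k}) ≤ N^{1-k}`). -/
structure IsAdmissible (k n : ℕ) (β σ ε K₁ : ℝ) (φ : ℝ → ℝ) : Prop where
  one_le_k : 1 ≤ k
  n_pos : 0 < n
  β_pos : 0 < β
  le_σ : (k : ℝ) + 1 ≤ σ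
  ε_pos : 0 < ε
  ε_le_one : ε ≤ 1
  meshFunction : IsMeshFunction (4 * n) φ
  lam_le : lam β σ ε (4 * n) ≤ 1 / 2
  mu_le : mu k β ε ≤ 1 / 2
  h₁_le : h₁ k β σ ε (4 * n) φ ≤ K₁ * ε
  exp_le : Real.exp (-ε ^ (-1 / (k : ℝ))) ≤ ((4 * n : ℕ) : ℝ) ^ (1 - (k : ℝ))

namespace IsAdmissible

variable {k n : ℕ} {β σ ε K₁ : ℝ} {φ : ℝ → ℝ} (h : IsAdmissible k n β σ ε K₁ φ)

include h

lemma σ_pos : 0 < σ :=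
  (by positivity : (0 : ℝ) < k + 1).trans_le h.le_σ

lemma one_le_N : (1 : ℝ) ≤ (4 * n : ℕ) := by
  have := h.n_pos
  exact_mod_cast (by lia : 1 ≤ 4 * n)

lemma N_pos : (0 : ℝ) < (4 * n : ℕ) :=
  one_pos.trans_le h.one_le_N

lemma one_div_n : 1 / (n : ℝ) = 4 * ((4 * n : ℕ) : ℝ)⁻¹ := by
  have := h.n_pos
  push_cast
  field_simp

lemma mu_nonneg : 0 ≤ mu k β ε := by
  have := h.β_pos
  have := h.ε_pos
  unfold mu
  split_ifs <;> positivity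

lemma monotone_node : Monotone (node k β σ ε (4 * n) φ) := by
  have hn := h.n_pos
  have hφ := h.meshFunction
  have hlam := h.lam_le
  have hmu := h.mu_le
  refine monotone_nat_of_le_succ fun i => ?_
  rcases lt_or_ge i n with h₁ | h₁
  · exact node_le_node_succ_of_lt h.β_pos h.σ_pos h.ε_pos hφ h₁
  rw [← sub_nonneg]
  rcases lt_or_ge i (2 * n) with h₂ | h₂
  · rw [node_succ_sub_node_of_le hn hφ h₁ h₂]
    exact div_nonneg (by linarith) (Nat.cast_nonneg n)
  rcases lt_or_ge i (3 * n) with h₃ | h₃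
  · rw [node_succ_sub_node_of_two_mul_le hn hφ h₂ h₃]
    exact div_nonneg h.mu_nonneg (Nat.cast_nonneg n)
  · rw [node_succ_sub_node_of_three_mul_le hn hφ h₃]
    exact div_nonneg (by linarith) (Nat.cast_nonneg n)

lemma lam_nonneg : 0 ≤ lam β σ ε (4 * n) := by
  rw [← node_eq_lam (k := k) h.n_pos h.meshFunction, ← node_zero (k := k) h.meshFunction]
  exact h.monotone_node (Nat.zero_le n)

lemma h₁_nonneg : 0 ≤ h₁ k β σ ε (4 * n) φ :=
  (sub_nonneg.2 (h.monotone_node (Nat.le_succ 0))).trans (node_succ_sub_node_le_h₁ h.n_pos)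

lemma K₁_nonneg : 0 ≤ K₁ :=
  nonneg_of_mul_nonneg_left (h.h₁_nonneg.trans h.h₁_le) h.ε_pos

lemma node_succ_sub_node_le (i : ℕ) :
    node k β σ ε (4 * n) φ (i + 1) - node k β σ ε (4 * n) φ i ≤
      h₁ k β σ ε (4 * n) φ + 1 / n := by
  have hn := h.n_pos
  have hφ := h.meshFunction
  have hlam := h.lam_nonneg
  have hmu := h.mu_nonneg
  have hmu' := h.mu_le
  have hh := h.h₁_nonneg
  have hdiv : ∀ z : ℝ, z ≤ 1 → z / n ≤ h₁ k β σ ε (4 * n) φ + 1 / n := fun z hz =>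
    (by gcongr : z / n ≤ 1 / n).trans (le_add_of_nonneg_left hh)
  rcases lt_or_ge i n with h₁ | h₁
  · exact (node_succ_sub_node_le_h₁ h₁).trans (le_add_of_nonneg_right (by positivity))
  rcases lt_or_ge i (2 * n) with h₂ | h₂
  · rw [node_succ_sub_node_of_le hn hφ h₁ h₂]
    exact hdiv _ (by linarith)
  rcases lt_or_ge i (3 * n) with h₃ | h₃
  · rw [node_succ_sub_node_of_two_mul_le hn hφ h₂ h₃]
    exact hdiv _ (by linarith)
  · rw [node_succ_sub_node_of_three_mul_le hn hφ h₃]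
    exact hdiv _ (by linarith)

lemma h₁_le_lam : h₁ k β σ ε (4 * n) φ ≤ lam β σ ε (4 * n) := by
  have hn := h.n_pos
  have : Nonempty (Fin (4 * n / 4)) := ⟨⟨0, by lia⟩⟩
  refine ciSup_le fun i => ?_
  have h_zero := h.monotone_node (Nat.zero_le (i : ℕ))
  have h_last := h.monotone_node (by lia : (i : ℕ) + 1 ≤ n)
  rw [node_zero h.meshFunction] at h_zero
  rw [node_eq_lam hn h.meshFunction] at h_last
  linarith

lemma one_le_maxAbsDerivPsi : 1 ≤ maxAbsDerivPsi φ := by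
  have := h.n_pos
  exact h.meshFunction.one_le_maxAbsDerivPsi (by lia)

lemma inv_N_le : ((4 * n : ℕ) : ℝ)⁻¹ ≤ ((4 * n : ℕ) : ℝ)⁻¹ * maxAbsDerivPsi φ :=
  le_mul_of_one_le_right (inv_nonneg.2 h.N_pos.le) h.one_le_maxAbsDerivPsi

lemma node_succ_sub_node_le_exp {i : ℕ} (hi : i < n) {y : ℝ}
    (hy : node k β σ ε (4 * n) φ i ≤ y) :
    node k β σ ε (4 * n) φ (i + 1) - node k β σ ε (4 * n) φ i ≤
      layerWidthConst β σ K₁ * ε * (((4 * n : ℕ) : ℝ)⁻¹ * maxAbsDerivPsi φ) *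
        Real.exp (β * y / (σ * ε)) := by
  have hβ := h.β_pos
  have hε := h.ε_pos
  have hσ := h.σ_pos
  have hM := h.one_le_maxAbsDerivPsi
  have hs := two_mul_div_mem_Icc hi.le
  have ht := two_mul_div_mem_Icc (i := i + 1) hi
  set s := 2 * (i : ℝ) / (4 * n : ℕ) with hs_def
  set t := 2 * ((i + 1 : ℕ) : ℝ) / (4 * n : ℕ) with ht_def
  have hts : t - s = 2 * ((4 * n : ℕ) : ℝ)⁻¹ := by
    rw [hs_def, ht_def]
    push_cast
    ring
  have hst : s ≤ t := sub_nonneg.1 (hts ▸ by positivity)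
  have hwidth := (node_succ_sub_node_le_h₁ (k := k) (β := β) (σ := σ) (ε := ε) (φ := φ) hi).trans
    h.h₁_le
  rw [node_of_le hi.le] at hwidth hy ⊢
  rw [node_of_le hi] at hwidth ⊢
  have hφ_le : φ t ≤ β * y / (σ * ε) + β * K₁ / σ := by
    calc φ t = β * (σ * ε / β * φ t) / (σ * ε) := by field_simp
      _ ≤ β * (y + K₁ * ε) / (σ * ε) := by
        gcongr
        linarith
      _ = β * y / (σ * ε) + β * K₁ / σ := by field_simp
  calc σ * ε / β * φ t - σ * ε / β * φ s = σ * ε / β * (φ t - φ s) := by ring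
    _ ≤ σ * ε / β * (Real.exp (β * y / (σ * ε) + β * K₁ / σ) *
        (maxAbsDerivPsi φ * (t - s))) := by
      gcongr
      refine (h.meshFunction.sub_le_exp_mul hs.1 hst ht.2).trans ?_
      have := sub_nonneg.2 hst
      gcongr
    _ = _ := by
      rw [hts, Real.exp_add, layerWidthConst]
      ring

lemma exp_lam_le : Real.exp (-(β / ε) * lam β σ ε (4 * n)) ≤ ((4 * n : ℕ) : ℝ)⁻¹ ^ (k + 1) := by
  have hβ := h.β_pos
  have hε := h.ε_pos
  have hexp : -(β / ε) * lam β σ ε (4 * n) = Real.log (4 * n : ℕ) * (-σ) := by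
    unfold lam
    field_simp
  rw [hexp, ← Real.rpow_def_of_pos h.N_pos, inv_pow, ← Real.rpow_natCast,
    ← Real.rpow_neg h.N_pos.le]
  refine Real.rpow_le_rpow_of_exponent_le h.one_le_N ?_
  push_cast
  linarith [h.le_σ]

/-- Half of the exponent yields `N^{-(k+1)}` because `λ ≤ 1/2`, the other half yields `√ε`. -/
lemma exp_le_sqrt : Real.exp (-(β / ε)) ≤ 2 / β * √ε * ((4 * n : ℕ) : ℝ)⁻¹ ^ (k + 1) := by
  have hβ := h.β_pos
  have hε := h.ε_pos
  have hN : Real.exp (-(β / ε) * (1 / 2)) ≤ ((4 * n : ℕ) : ℝ)⁻¹ ^ (k + 1) := by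
    refine le_trans (Real.exp_le_exp.2 ?_) h.exp_lam_le
    exact mul_le_mul_of_nonpos_left h.lam_le (neg_nonpos.2 (by positivity))
  have hsqrt : Real.exp (-(β / (2 * ε))) ≤ 2 / β * √ε :=
    calc Real.exp (-(β / (2 * ε))) ≤ (β / (2 * ε))⁻¹ := by
          rw [Real.exp_neg]
          exact inv_anti₀ (by positivity) (by linarith [Real.add_one_le_exp (β / (2 * ε))])
      _ = 2 / β * ε := by field_simp
      _ ≤ 2 / β * √ε := by
          gcongr
          exact Real.le_sqrt_of_sq_le (pow_le_of_le_one hε.le h.ε_le_one two_ne_zero)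
  calc Real.exp (-(β / ε)) = Real.exp (-(β / (2 * ε))) * Real.exp (-(β / ε) * (1 / 2)) := by
        rw [← Real.exp_add]
        congr 1
        field_simp
        norm_num
    _ ≤ 2 / β * √ε * ((4 * n : ℕ) : ℝ)⁻¹ ^ (k + 1) := by gcongr

lemma mu_pow_le : mu k β ε ^ k ≤ (1 + 1 / β) ^ k * ε ^ (k - 1) := by
  have hβ := h.β_pos
  have hε := h.ε_pos
  have hk := h.one_le_k
  have hmu : mu k β ε ≤ (1 + 1 / β) * ε ^ (((k : ℝ) - 1) / k) := by
    have hβ' : 0 < β⁻¹ := inv_pos.2 hβ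
    unfold mu
    split_ifs with hk1
    · subst hk1
      norm_num
      linarith
    · rw [div_eq_mul_one_div, mul_comm, one_div]
      gcongr
      linarith
  refine (pow_le_pow_left₀ h.mu_nonneg hmu k).trans_eq ?_
  rw [mul_pow, ← Real.rpow_natCast (ε ^ _), ← Real.rpow_mul hε.le,
    div_mul_cancel₀ _ (by positivity), ← Real.rpow_natCast ε, Nat.cast_sub hk, Nat.cast_one]

lemma exp_mu_le : Real.exp (-(β / ε) * mu k β ε) ≤ ((4 * n : ℕ) : ℝ)⁻¹ ^ (k - 1) := by
  have hβ := h.β_pos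
  have hε := h.ε_pos
  have hk := h.one_le_k
  by_cases hk1 : k = 1
  · rw [hk1, Nat.sub_self, pow_zero, Real.exp_le_one_iff, neg_mul, neg_nonpos, ← hk1]
    exact mul_nonneg (by positivity) h.mu_nonneg
  have hpow : ε ^ (((k : ℝ) - 1) / k) = ε ^ (-1 / (k : ℝ)) * ε := by
    rw [← Real.rpow_add_one hε.ne']
    congr 1
    field_simp
    ring
  have hexp : -(β / ε) * mu k β ε = -ε ^ (-1 / (k : ℝ)) := by
    rw [mu, if_neg hk1, hpow]
    field_simp
  rw [hexp, inv_pow, ← Real.rpow_natCast, ← Real.rpow_neg h.N_pos.le, Nat.cast_sub hk, neg_sub,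
    Nat.cast_one]
  exact h.exp_le

end IsAdmissible

/-! ### Interpolation of exponentially decaying functions -/

lemma L2norm_Ioo_le_add (v : ℝ → ℝ) {a b c : ℝ} (hab : a ≤ b) (hbc : b ≤ c) :
    L2norm v (Ioo a c) ≤ L2norm v (Ioo a b) + L2norm v (Ioo b c) := by
  rw [← L2norm_Ico, ← L2norm_Ico v a b, ← L2norm_Ico v b c, ← Ico_union_Ico_eq_Ico hab hbc]
  exact L2norm_union_le v _ _

lemma L2norm_exp_neg_mul_Ioi {α : ℝ} (hα : 0 < α) (c : ℝ) :
    L2norm (fun y => Real.exp (-α * y)) (Ioi c) =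
      ENNReal.ofReal (Real.exp (-α * c) / √(2 * α)) := by
  have hα' : -(2 * α) < 0 := by linarith
  have hsq : ∀ y, Real.exp (-α * y) ^ 2 = Real.exp (-(2 * α) * y) := fun y => by
    rw [← Real.exp_nat_mul]
    congr 1
    push_cast
    ring
  refine (ENNReal.pow_right_strictMono two_ne_zero).injective ?_
  calc L2norm (fun y => Real.exp (-α * y)) (Ioi c) ^ 2
      = ∫⁻ y in Ioi c, ENNReal.ofReal (Real.exp (-(2 * α) * y)) := by
        rw [L2norm_sq]
        refine lintegral_congr fun y => ?_
        rw [Real.enorm_eq_ofReal (Real.exp_nonneg _), ← ENNReal.ofReal_pow (Real.exp_nonneg _),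
          hsq]
    _ = ENNReal.ofReal (∫ y in Ioi c, Real.exp (-(2 * α) * y)) :=
        (ofReal_integral_eq_lintegral_ofReal (integrableOn_exp_mul_Ioi hα' c)
          (Eventually.of_forall fun y => Real.exp_nonneg _)).symm
    _ = ENNReal.ofReal (Real.exp (-α * c) / √(2 * α)) ^ 2 := by
        rw [← ENNReal.ofReal_pow (by positivity), integral_exp_mul_Ioi hα', neg_div_neg_eq, div_pow,
          hsq, Real.sq_sqrt (by positivity)]

lemma L2norm_exp_le {A α : ℝ} (hA : 0 ≤ A) (hα : 0 < α) (s c d : ℝ) :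
    L2norm (fun y => A * Real.exp (-α * (y - s))) (Ioo c d) ≤
      ENNReal.ofReal (A * Real.exp (-α * (c - s)) / √α) := by
  have hexp : ∀ y, A * Real.exp (-α * (y - s)) = A * Real.exp (α * s) * Real.exp (-α * y) :=
    fun y => by
      rw [mul_assoc, ← Real.exp_add]
      ring_nf
  calc L2norm (fun y => A * Real.exp (-α * (y - s))) (Ioo c d)
      = L2norm (fun y => |A * Real.exp (α * s) * Real.exp (-α * y)|) (Ioo c d) :=
        L2norm_congr measurableSet_Ioo fun y _ => by
          rw [abs_of_nonneg (by positivity), ← hexp]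
    _ ≤ ENNReal.ofReal (A * Real.exp (α * s)) * L2norm (fun y => Real.exp (-α * y)) (Ioi c) := by
        rw [L2norm_abs_const_mul, abs_of_nonneg (by positivity)]
        gcongr
        exact L2norm_mono_set Ioo_subset_Ioi_self
    _ = ENNReal.ofReal (A * Real.exp (-α * (c - s)) / √(2 * α)) := by
        rw [L2norm_exp_neg_mul_Ioi hα, ← ENNReal.ofReal_mul (by positivity), mul_div_assoc', hexp]
    _ ≤ ENNReal.ofReal (A * Real.exp (-α * (c - s)) / √α) := by
        gcongr
        linarith

lemma IsReferenceGrid.L2norm_sub_interpDeriv_le_of_exp {k m N p q j : ℕ} {ξ : Fin (k + 1) → ℝ}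
    {Λ : ℝ} {x : ℕ → ℝ} {D : ℕ → ℝ → ℝ} (h : IsReferenceGrid ξ Λ) (hx : Monotone x)
    (hpq : p ≤ q) (hq : q ≤ N) (hm : m ≤ k) (hD : IsSobolevJet (x p) (x q) (m + 1) D)
    (hj : j ≤ m + 1) {H A α s : ℝ} (hH₀ : 0 ≤ H) (hA : 0 ≤ A) (hα : 0 < α)
    (hH : ∀ i, p ≤ i → i < q → x (i + 1) - x i ≤ H)
    (hbound : ∀ y ∈ Ioo (x p) (x q), |D (m + 1) y| ≤ A * Real.exp (-α * (y - s))) :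
    L2norm (D j - interpDeriv ξ N x j (D 0)) (Ioo (x p) (x q)) ≤
      ENNReal.ofReal ((1 + Λ) * (H ^ (m + 1 - j) * A * Real.exp (-α * (x p - s)) / √α)) := by
  have hΛ := h.nonneg
  rw [ENNReal.ofReal_mul (by positivity)]
  refine (h.L2norm_sub_interpDeriv_le hx hpq hq hm hD hj
    (g := fun y => H ^ (m + 1 - j) * A * Real.exp (-α * (y - s))) fun i hpi hiq y hy => ?_).trans ?_
  · have hwidth := sub_nonneg.2 (hx (Nat.le_succ i))
    have hy' : y ∈ Ioo (x p) (x q) := ⟨(hx hpi).trans_lt hy.1, hy.2.trans_le (hx hiq)⟩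
    rw [mul_assoc]
    gcongr
    exacts [hH i hpi hiq, hbound y hy']
  · gcongr
    exact L2norm_exp_le (by positivity) hα s _ _

/-- Interpolates between the two bounds on `w`, so that only the power `p` of the growing factor
`exp θ` has to be paid. -/
lemma pow_le_mul_rpow_mul_exp {w B c Y θ p : ℝ} {r : ℕ} (hw : 0 ≤ w) (hwB : w ≤ B) (hc : 0 ≤ c)
    (hY : 0 ≤ Y) (hwY : w ≤ c * Y * Real.exp θ) (hp : 0 ≤ p) (hpr : p ≤ r) :
    w ^ r ≤ ((1 + B) * (1 + c)) ^ r * Y ^ p * Real.exp (p * θ) := by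
  have hB : 0 ≤ B := hw.trans hwB
  have hrest : w ^ ((r : ℝ) - p) ≤ (1 + B) ^ r :=
    calc w ^ ((r : ℝ) - p) ≤ (1 + B) ^ ((r : ℝ) - p) :=
          Real.rpow_le_rpow hw (by linarith) (by linarith)
      _ ≤ (1 + B) ^ (r : ℝ) := Real.rpow_le_rpow_of_exponent_le (by linarith) (by linarith)
      _ = (1 + B) ^ r := Real.rpow_natCast _ _
  have hcp : c ^ p ≤ (1 + c) ^ r :=
    calc c ^ p ≤ (1 + c) ^ p := Real.rpow_le_rpow hc (by linarith) hp
      _ ≤ (1 + c) ^ (r : ℝ) := Real.rpow_le_rpow_of_exponent_le (by linarith) hpr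
      _ = (1 + c) ^ r := Real.rpow_natCast _ _
  calc w ^ r = w ^ ((r : ℝ) - p) * w ^ p := by
        rw [← Real.rpow_add_of_nonneg hw (by linarith) hp, sub_add_cancel, Real.rpow_natCast]
    _ ≤ (1 + B) ^ r * (c * Y * Real.exp θ) ^ p := by gcongr
    _ = (1 + B) ^ r * (c ^ p * Y ^ p * Real.exp (p * θ)) := by
        rw [Real.mul_rpow (by positivity) (Real.exp_nonneg θ), Real.mul_rpow hc hY, ← Real.exp_mul,
          mul_comm θ]
    _ ≤ (1 + B) ^ r * ((1 + c) ^ r * Y ^ p * Real.exp (p * θ)) := by gcongr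
    _ = ((1 + B) * (1 + c)) ^ r * Y ^ p * Real.exp (p * θ) := by
        rw [mul_pow]
        ring

/-! ### The parts of the solution -/

/-- `E` is smooth on `(0, 2)` and its derivatives of order `ℓ ≤ m` are bounded by
`K ε^{-ℓ} exp (-β y / ε)`, as for an exponential layer at `0`. -/
structure IsStrongLayer (m : ℕ) (β ε K : ℝ) (E : ℝ → ℝ) : Prop where
  contDiffOn : ContDiffOn ℝ m E (Ioo 0 2)
  abs_iteratedDeriv_le : ∀ ℓ ≤ m, ∀ y ∈ Ioo (0 : ℝ) 2,
    |iteratedDeriv ℓ E y| ≤ K * (ε ^ ℓ)⁻¹ * Real.exp (-(β / ε) * (y - 0))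

/-- `W` vanishes on `(0, 1)`, is smooth on `(1, 2)`, and its derivatives of order `ℓ ≤ m` are
bounded there by `K ε^{1-ℓ} exp (-β (y - 1) / ε)`, as for an exponential layer at `1` of
amplitude `ε`. -/
structure IsWeakLayer (m : ℕ) (β ε K : ℝ) (W : ℝ → ℝ) : Prop where
  eqOn_zero : EqOn W 0 (Ioo 0 1)
  contDiffOn : ContDiffOn ℝ m W (Ioo 1 2)
  abs_iteratedDeriv_le : ∀ ℓ ≤ m, ∀ y ∈ Ioo (1 : ℝ) 2,
    |iteratedDeriv ℓ W y| ≤ K * (ε * (ε ^ ℓ)⁻¹) * Real.exp (-(β / ε) * (y - 1))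

section Parts

variable {m : ℕ} {β ε K : ℝ} {u S E W : ℝ → ℝ}

lemma IsDecomposition.isStrongLayer (h : IsDecomposition m β ε K u S E W) (hε : 0 < ε) :
    IsStrongLayer m β ε K E where
  contDiffOn := h.contDiffOn_E
  abs_iteratedDeriv_le ℓ hℓ y hy := by
    convert h.bound_E ℓ hℓ y hy using 3
    · rw [Real.rpow_neg hε.le, Real.rpow_natCast]
    · ring

lemma IsDecomposition.isWeakLayer (h : IsDecomposition m β ε K u S E W) (hε : 0 < ε) :
    IsWeakLayer m β ε K W where
  eqOn_zero := h.W_eq_zero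
  contDiffOn := h.contDiffOn_W
  abs_iteratedDeriv_le ℓ hℓ y hy := by
    convert h.bound_W ℓ hℓ y hy using 3
    · rw [Real.rpow_sub hε, Real.rpow_one, Real.rpow_natCast, div_eq_mul_inv]
    · ring

lemma mul_exp_neg_le {A s y : ℝ} (hA : 0 ≤ A) (hβ : 0 < β) (hε : 0 < ε) (hy : s ≤ y) :
    A * Real.exp (-(β / ε) * (y - s)) ≤ A := by
  refine mul_le_of_le_one_right hA (Real.exp_le_one_iff.2 ?_)
  rw [neg_mul, neg_nonpos]
  exact mul_nonneg (by positivity) (sub_nonneg.2 hy)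

lemma IsStrongLayer.K_nonneg (h : IsStrongLayer m β ε K E) : 0 ≤ K := by
  have hbound := (abs_nonneg _).trans
    (h.abs_iteratedDeriv_le 0 m.zero_le 1 ⟨one_pos, one_lt_two⟩)
  rw [pow_zero, inv_one, mul_one] at hbound
  exact nonneg_of_mul_nonneg_left hbound (Real.exp_pos _)

lemma IsStrongLayer.isSobolevJet (h : IsStrongLayer (m + 1) β ε K E) (hβ : 0 < β) (hε : 0 < ε) :
    IsSobolevJet 0 2 (m + 1) (fun ℓ => iteratedDeriv ℓ E) := by
  have hK := h.K_nonneg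
  exact .of_contDiffOn zero_lt_two h.contDiffOn fun ℓ hℓ => ⟨K * (ε ^ ℓ)⁻¹, fun y hy =>
    (h.abs_iteratedDeriv_le ℓ hℓ y hy).trans (mul_exp_neg_le (by positivity) hβ hε hy.1.le)⟩

lemma IsWeakLayer.K_nonneg (h : IsWeakLayer m β ε K W) (hε : 0 < ε) : 0 ≤ K := by
  have hbound := (abs_nonneg _).trans
    (h.abs_iteratedDeriv_le 0 m.zero_le (3 / 2) ⟨by norm_num, by norm_num⟩)
  rw [pow_zero, inv_one, mul_one] at hbound
  exact nonneg_of_mul_nonneg_left (nonneg_of_mul_nonneg_left hbound (Real.exp_pos _)) hε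

lemma IsWeakLayer.isSobolevJet_left (h : IsWeakLayer (m + 1) β ε K W) :
    IsSobolevJet 0 1 (m + 1) (fun ℓ => iteratedDeriv ℓ W) :=
  .of_contDiffOn zero_lt_one (contDiffOn_const.congr h.eqOn_zero) fun ℓ _ => ⟨0, fun y hy => by
    rw [iteratedDeriv_eqOn_zero isOpen_Ioo h.eqOn_zero ℓ hy, Pi.zero_apply, abs_zero]⟩

lemma IsWeakLayer.isSobolevJet_right (h : IsWeakLayer (m + 1) β ε K W) (hβ : 0 < β)
    (hε : 0 < ε) : IsSobolevJet 1 2 (m + 1) (fun ℓ => iteratedDeriv ℓ W) := by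
  have hK := h.K_nonneg hε
  exact .of_contDiffOn one_lt_two h.contDiffOn fun ℓ hℓ => ⟨K * (ε * (ε ^ ℓ)⁻¹), fun y hy =>
    (h.abs_iteratedDeriv_le ℓ hℓ y hy).trans (mul_exp_neg_le (by positivity) hβ hε hy.1.le)⟩

end Parts

/-! ### Interpolation errors of the parts -/

namespace IsAdmissible

variable {k n j : ℕ} {ξ : Fin (k + 1) → ℝ} {β σ ε K K₁ Λ : ℝ} {φ S E W : ℝ → ℝ}

section Widths

variable (h : IsAdmissible k n β σ ε K₁ φ)

include h

lemma inv_N_mul_maxAbsDerivPsi_nonneg : 0 ≤ ((4 * n : ℕ) : ℝ)⁻¹ * maxAbsDerivPsi φ :=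
  (inv_nonneg.2 h.N_pos.le).trans h.inv_N_le

lemma layerWidthConst_nonneg : 0 ≤ layerWidthConst β σ K₁ := by
  have := h.β_pos
  have := h.σ_pos
  unfold layerWidthConst
  positivity

lemma node_mem_Icc {i : ℕ} (hi : i ≤ 4 * n) : node k β σ ε (4 * n) φ i ∈ Icc (0 : ℝ) 2 := by
  rw [← node_zero (k := k) (β := β) (σ := σ) (ε := ε) h.meshFunction,
    ← node_four_mul (k := k) (β := β) (σ := σ) (ε := ε) h.n_pos h.meshFunction]
  exact ⟨h.monotone_node i.zero_le, h.monotone_node hi⟩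

/-- Here `σ ≥ k + 1` leaves half a power of the decay to integrate. -/
lemma exp_mul_exp_neg_le {p y : ℝ} (hp : p ≤ k + 1 / 2) (hy : 0 ≤ y) :
    Real.exp (p * (β * y / (σ * ε))) * Real.exp (-(β / ε) * (y - 0)) ≤
      Real.exp (-(β / (2 * σ * ε)) * (y - 0)) := by
  have hβ := h.β_pos
  have hε := h.ε_pos
  have hσ := h.σ_pos
  have : 0 ≤ β * y / (σ * ε) := by positivity
  rw [← Real.exp_add, Real.exp_le_exp]
  calc p * (β * y / (σ * ε)) + -(β / ε) * (y - 0) = (p - σ) * (β * y / (σ * ε)) := by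
        field_simp
        ring
    _ ≤ -(1 / 2) * (β * y / (σ * ε)) := by
        gcongr
        linarith [h.le_σ]
    _ = -(β / (2 * σ * ε)) * (y - 0) := by
        field_simp
        ring

lemma pow_width_mul_abs_iteratedDeriv_le (hE : IsStrongLayer (k + 1) β ε K E) (hj : j ≤ k + 1)
    {p : ℝ} (hp : 0 ≤ p) (hpj : p ≤ (k + 1 - j : ℕ)) (hpk : p ≤ k + 1 / 2) {i : ℕ} (hi : i < n)
    {y : ℝ} (hy : y ∈ Ioo (node k β σ ε (4 * n) φ i) (node k β σ ε (4 * n) φ (i + 1))) :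
    (node k β σ ε (4 * n) φ (i + 1) - node k β σ ε (4 * n) φ i) ^ (k + 1 - j) *
        |iteratedDeriv (k + 1) E y| ≤
      K * (ε ^ j)⁻¹ * ((1 + K₁) * (1 + layerWidthConst β σ K₁)) ^ (k + 1 - j) *
        (((4 * n : ℕ) : ℝ)⁻¹ * maxAbsDerivPsi φ) ^ p *
        Real.exp (-(β / (2 * σ * ε)) * (y - 0)) := by
  have hε := h.ε_pos
  have hK := hE.K_nonneg
  have hK₁ := h.K₁_nonneg
  have hc := h.layerWidthConst_nonneg
  have hY := h.inv_N_mul_maxAbsDerivPsi_nonneg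
  have hy₀ := (h.node_mem_Icc (by lia : i ≤ 4 * n)).1.trans_lt hy.1
  have hy₂ := hy.2.trans_le (h.node_mem_Icc (by lia : i + 1 ≤ 4 * n)).2
  have hw := sub_nonneg.2 (h.monotone_node (Nat.le_succ i))
  have hw_le := (node_succ_sub_node_le_h₁ hi).trans h.h₁_le
  have hw_exp := h.node_succ_sub_node_le_exp hi hy.1.le
  set w := node k β σ ε (4 * n) φ (i + 1) - node k β σ ε (4 * n) φ i
  set Y := ((4 * n : ℕ) : ℝ)⁻¹ * maxAbsDerivPsi φ
  set θ := β * y / (σ * ε)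
  have hpow := pow_le_mul_rpow_mul_exp (θ := θ) (div_nonneg hw hε.le) ((div_le_iff₀ hε).2 hw_le)
    hc hY ((div_le_iff₀ hε).2 (hw_exp.trans_eq (by ring))) hp hpj
  have hε_pow : ε ^ (k + 1) = ε ^ (k + 1 - j) * ε ^ j := by
    rw [← pow_add, Nat.sub_add_cancel hj]
  calc w ^ (k + 1 - j) * |iteratedDeriv (k + 1) E y|
      ≤ w ^ (k + 1 - j) * (K * (ε ^ (k + 1))⁻¹ * Real.exp (-(β / ε) * (y - 0))) := by
        gcongr
        exact hE.abs_iteratedDeriv_le (k + 1) le_rfl y ⟨hy₀, hy₂⟩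
    _ = K * (ε ^ j)⁻¹ * (w / ε) ^ (k + 1 - j) * Real.exp (-(β / ε) * (y - 0)) := by
        rw [hε_pow, mul_inv, div_pow]
        field_simp
    _ ≤ K * (ε ^ j)⁻¹ * (((1 + K₁) * (1 + layerWidthConst β σ K₁)) ^ (k + 1 - j) * Y ^ p *
          Real.exp (p * θ)) * Real.exp (-(β / ε) * (y - 0)) := by gcongr
    _ = K * (ε ^ j)⁻¹ * ((1 + K₁) * (1 + layerWidthConst β σ K₁)) ^ (k + 1 - j) * Y ^ p *
          (Real.exp (p * θ) * Real.exp (-(β / ε) * (y - 0))) := by ring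
    _ ≤ K * (ε ^ j)⁻¹ * ((1 + K₁) * (1 + layerWidthConst β σ K₁)) ^ (k + 1 - j) * Y ^ p *
          Real.exp (-(β / (2 * σ * ε)) * (y - 0)) := by
        gcongr
        exact h.exp_mul_exp_neg_le hpk hy₀.le

lemma width_weakLayer_pow_le : (mu k β ε / n) ^ k * (ε ^ (k - 1))⁻¹ ≤
    (4 * (1 + 1 / β)) ^ k * ((4 * n : ℕ) : ℝ)⁻¹ ^ k := by
  have hε := h.ε_pos
  have hN := h.N_pos
  rw [div_eq_mul_one_div, h.one_div_n, mul_pow, mul_inv_le_iff₀ (by positivity)]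
  calc mu k β ε ^ k * (4 * ((4 * n : ℕ) : ℝ)⁻¹) ^ k
      ≤ (1 + 1 / β) ^ k * ε ^ (k - 1) * (4 * ((4 * n : ℕ) : ℝ)⁻¹) ^ k := by
        gcongr
        exact h.mu_pow_le
    _ = (4 * (1 + 1 / β)) ^ k * ((4 * n : ℕ) : ℝ)⁻¹ ^ k * ε ^ (k - 1) := by
        rw [mul_pow, mul_pow]
        ring

lemma width_weakLayer_pow_le_inv (hj : j ≤ 1) :
    (mu k β ε / n) ^ (k + 1 - j) * (ε ^ k)⁻¹ ≤
      4 * (4 * (1 + 1 / β)) ^ k * (ε⁻¹ * ((4 * n : ℕ) : ℝ)⁻¹ ^ (k + 1 - j)) := by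
  have hβ := h.β_pos
  have hε := h.ε_pos
  have hk := h.one_le_k
  have hν := inv_pos.2 h.N_pos
  have hmu : mu k β ε / n ≤ 4 * ((4 * n : ℕ) : ℝ)⁻¹ := by
    rw [← h.one_div_n]
    gcongr
    linarith [h.mu_le]
  have hmu₀ := div_nonneg h.mu_nonneg n.cast_nonneg
  have hwidth := h.width_weakLayer_pow_le
  set ν := ((4 * n : ℕ) : ℝ)⁻¹
  calc (mu k β ε / n) ^ (k + 1 - j) * (ε ^ k)⁻¹
      = (mu k β ε / n) ^ (1 - j) * ((mu k β ε / n) ^ k * (ε ^ (k - 1))⁻¹) * ε⁻¹ := by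
        rw [← mul_pow_sub_one (by lia : k ≠ 0) ε, mul_inv,
          (by lia : k + 1 - j = 1 - j + k), pow_add]
        ring
    _ ≤ (4 * ν) ^ (1 - j) * ((4 * (1 + 1 / β)) ^ k * ν ^ k) * ε⁻¹ := by gcongr
    _ = 4 ^ (1 - j) * (4 * (1 + 1 / β)) ^ k * (ε⁻¹ * ν ^ (k + 1 - j)) := by
        rw [(by lia : k + 1 - j = 1 - j + k), pow_add ν, mul_pow 4 ν]
        ring
    _ ≤ 4 * (4 * (1 + 1 / β)) ^ k * (ε⁻¹ * ν ^ (k + 1 - j)) := by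
        gcongr
        exact (pow_le_pow_right₀ (by norm_num) (Nat.sub_le 1 j)).trans_eq (pow_one 4)

end Widths

variable (h : IsAdmissible k n β σ ε K₁ φ) (hξ : IsReferenceGrid ξ Λ)

include h hξ

lemma L2norm_strongLayer_fine_le (hE : IsStrongLayer (k + 1) β ε K E) (hj : j ≤ k + 1) {p : ℝ}
    (hp : 0 ≤ p) (hpj : p ≤ (k + 1 - j : ℕ)) (hpk : p ≤ k + 1 / 2) :
    L2norm (iteratedDeriv j E - interpDeriv ξ (4 * n) (node k β σ ε (4 * n) φ) j E)
        (Ioo 0 (lam β σ ε (4 * n))) ≤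
      ENNReal.ofReal ((1 + Λ) * (K * ((1 + K₁) * (1 + layerWidthConst β σ K₁)) ^ (k + 1) *
        √(2 * σ / β)) * (√ε * (ε ^ j)⁻¹ * (((4 * n : ℕ) : ℝ)⁻¹ * maxAbsDerivPsi φ) ^ p)) := by
  have hβ := h.β_pos
  have hε := h.ε_pos
  have hσ := h.σ_pos
  have hK := hE.K_nonneg
  have hK₁ := h.K₁_nonneg
  have hΛ := hξ.nonneg
  have hc := h.layerWidthConst_nonneg
  have hY := h.inv_N_mul_maxAbsDerivPsi_nonneg
  have hsqrt : √(β / (2 * σ * ε)) = (√(2 * σ / β) * √ε)⁻¹ := by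
    rw [← Real.sqrt_mul (by positivity), ← Real.sqrt_inv]
    congr 1
    field_simp
  have hjet := (hE.isSobolevJet hβ hε).mono (h.node_mem_Icc (Nat.zero_le _)).1
    (h.node_mem_Icc (by lia : n ≤ 4 * n)).2 le_rfl
  have herror := (hξ.L2norm_sub_interpDeriv_le (N := 4 * n) h.monotone_node n.zero_le (by lia)
    le_rfl hjet hj fun i _ hi y hy =>
      h.pow_width_mul_abs_iteratedDeriv_le hE hj hp hpj hpk hi hy).trans
    (mul_le_mul_right (L2norm_exp_le (by positivity) (by positivity) _ _ _) _)
  rw [node_zero h.meshFunction, node_eq_lam h.n_pos h.meshFunction,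
    ← ENNReal.ofReal_mul (by positivity), iteratedDeriv_zero] at herror
  refine herror.trans (ENNReal.ofReal_le_ofReal ?_)
  rw [sub_self, mul_zero, Real.exp_zero, mul_one, hsqrt, div_inv_eq_mul]
  set B := (1 + K₁) * (1 + layerWidthConst β σ K₁)
  have hB : 1 ≤ B := one_le_mul_of_one_le_of_one_le (by linarith) (by linarith)
  have hB_pow : B ^ (k + 1 - j) ≤ B ^ (k + 1) := pow_le_pow_right₀ hB (Nat.sub_le _ _)
  calc _ = (1 + Λ) * (K * B ^ (k + 1 - j) * √(2 * σ / β)) * (√ε * (ε ^ j)⁻¹ *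
          (((4 * n : ℕ) : ℝ)⁻¹ * maxAbsDerivPsi φ) ^ p) := by ring
    _ ≤ _ := by gcongr

lemma L2norm_strongLayer_tail_le (hE : IsStrongLayer (k + 1) β ε K E) {p q : ℕ} (hpq : p ≤ q)
    (hq : q ≤ 4 * n) (hlen : node k β σ ε (4 * n) φ q - node k β σ ε (4 * n) φ p ≤ 1) :
    L2norm (E - interp ξ (4 * n) (node k β σ ε (4 * n) φ) E)
        (Ioo (node k β σ ε (4 * n) φ p) (node k β σ ε (4 * n) φ q)) ≤
      ENNReal.ofReal ((1 + Λ) * (K * Real.exp (-(β / ε) * node k β σ ε (4 * n) φ p))) := by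
  have hβ := h.β_pos
  have hε := h.ε_pos
  have hK := hE.K_nonneg
  have hΛ := hξ.nonneg
  have hp₀ := (h.node_mem_Icc (hpq.trans hq)).1
  have hq₂ := (h.node_mem_Icc hq).2
  have herror := hξ.L2norm_sub_interp_le_of_abs_le h.monotone_node hpq hq
    ((hE.isSobolevJet hβ hε).mono hp₀ hq₂ le_rfl)
    (R := K * Real.exp (-(β / ε) * node k β σ ε (4 * n) φ p)) fun y hy => by
      refine (hE.abs_iteratedDeriv_le 0 (Nat.zero_le _) y
        ⟨hp₀.trans_lt hy.1, hy.2.trans_le hq₂⟩).trans ?_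
      rw [pow_zero, inv_one, mul_one, sub_zero, neg_mul, neg_mul]
      gcongr
      exact hy.1.le
  rw [iteratedDeriv_zero] at herror
  refine herror.trans (ENNReal.ofReal_le_ofReal ?_)
  rw [mul_assoc (1 + Λ)]
  refine mul_le_mul_of_nonneg_left ?_ (by positivity)
  exact mul_le_of_le_one_right (by positivity) (Real.sqrt_le_one.2 hlen)

lemma L2norm_strongLayer_tail_deriv_le (hE : IsStrongLayer (k + 1) β ε K E) {p q : ℕ}
    (hpq : p ≤ q) (hq : q ≤ 4 * n)
    (hlen : node k β σ ε (4 * n) φ q - node k β σ ε (4 * n) φ p ≤ 1) :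
    L2norm (iteratedDeriv 1 E - interpDeriv ξ (4 * n) (node k β σ ε (4 * n) φ) 1 E)
        (Ioo (node k β σ ε (4 * n) φ p) (node k β σ ε (4 * n) φ q)) ≤
      ENNReal.ofReal ((1 + Λ) * (K / √β * (√ε * ε⁻¹ *
        Real.exp (-(β / ε) * node k β σ ε (4 * n) φ p)))) := by
  have hβ := h.β_pos
  have hε := h.ε_pos
  have hK := hE.K_nonneg
  have hp₀ := (h.node_mem_Icc (hpq.trans hq)).1
  have hq₂ := (h.node_mem_Icc hq).2
  have herror := hξ.L2norm_sub_interpDeriv_le_of_exp h.monotone_node hpq hq k.zero_le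
    ((hE.isSobolevJet hβ hε).mono hp₀ hq₂ (by lia)) le_rfl (A := K * (ε ^ 1)⁻¹) (α := β / ε)
    (s := 0) zero_le_one (by positivity) (by positivity)
    (fun i hpi hiq => (sub_le_sub (h.monotone_node hiq) (h.monotone_node hpi)).trans hlen)
    fun y hy => hE.abs_iteratedDeriv_le 1 (by lia) y ⟨hp₀.trans_lt hy.1, hy.2.trans_le hq₂⟩
  rw [iteratedDeriv_zero] at herror
  refine herror.trans_eq ?_
  rw [Real.sqrt_div hβ.le]
  simp only [zero_add, Nat.sub_self, pow_zero, pow_one, one_mul, sub_zero]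
  field_simp

lemma L2norm_weakLayer_left_eq_zero (hW : IsWeakLayer (k + 1) β ε K W) (hj : j ≤ k + 1) :
    L2norm (iteratedDeriv j W - interpDeriv ξ (4 * n) (node k β σ ε (4 * n) φ) j W)
      (Ioo 0 1) = 0 := by
  have hn := h.n_pos
  have hφ := h.meshFunction
  have hjet := hW.isSobolevJet_left
  have hzero := node_zero (k := k) (β := β) (σ := σ) (ε := ε) hφ
  have hone := node_two_mul (k := k) (β := β) (σ := σ) (ε := ε) hn hφ
  rw [← hzero, ← hone] at hjet ⊢
  have herror := hξ.L2norm_sub_interpDeriv_le (N := 4 * n) h.monotone_node (Nat.zero_le _)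
    (by lia) le_rfl hjet hj (g := fun _ => 0) fun i _ hi₁ y hy => by
      have hy' : y ∈ Ioo (0 : ℝ) 1 :=
        ⟨(h.node_mem_Icc (by lia : i ≤ 4 * n)).1.trans_lt hy.1,
          hy.2.trans_le (hone ▸ h.monotone_node hi₁)⟩
      rw [iteratedDeriv_eqOn_zero isOpen_Ioo hW.eqOn_zero _ hy', Pi.zero_apply, abs_zero, mul_zero]
  rw [iteratedDeriv_zero] at herror
  refine le_antisymm (herror.trans_eq ?_) zero_le
  rw [L2norm, eLpNorm_zero', mul_zero]

lemma L2norm_weakLayer_right_le (hW : IsWeakLayer (k + 1) β ε K W) {p q m : ℕ}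
    (hp : 2 * n ≤ p) (hpq : p ≤ q) (hq : q ≤ 4 * n) (hm : m ≤ k) (hj : j ≤ m + 1) {H : ℝ}
    (hH₀ : 0 ≤ H)
    (hH : ∀ i, p ≤ i → i < q → node k β σ ε (4 * n) φ (i + 1) - node k β σ ε (4 * n) φ i ≤ H) :
    L2norm (iteratedDeriv j W - interpDeriv ξ (4 * n) (node k β σ ε (4 * n) φ) j W)
        (Ioo (node k β σ ε (4 * n) φ p) (node k β σ ε (4 * n) φ q)) ≤
      ENNReal.ofReal ((1 + Λ) * (K * (√ε / √β) * (H ^ (m + 1 - j) * (ε ^ m)⁻¹ *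
        Real.exp (-(β / ε) * (node k β σ ε (4 * n) φ p - 1))))) := by
  have hβ := h.β_pos
  have hε := h.ε_pos
  have hK := hW.K_nonneg hε
  have hp₁ := h.monotone_node hp
  rw [node_two_mul h.n_pos h.meshFunction] at hp₁
  have hq₂ := (h.node_mem_Icc hq).2
  have herror := hξ.L2norm_sub_interpDeriv_le_of_exp h.monotone_node hpq hq hm
    ((hW.isSobolevJet_right hβ hε).mono hp₁ hq₂ (by lia)) hj (A := K * (ε * (ε ^ (m + 1))⁻¹))
    (α := β / ε) (s := 1) hH₀ (by positivity) (by positivity) hH fun y hy =>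
      hW.abs_iteratedDeriv_le (m + 1) (by lia) y ⟨hp₁.trans_lt hy.1, hy.2.trans_le hq₂⟩
  rw [iteratedDeriv_zero] at herror
  refine herror.trans_eq ?_
  rw [Real.sqrt_div hβ.le, pow_succ]
  field_simp

/-- The orders `m + 1` and `m' + 1` of the derivatives used on `(1, 1 + μ)` and on `(1 + μ, 2)` may
differ. -/
lemma L2norm_weakLayer_le (hW : IsWeakLayer (k + 1) β ε K W) {m m' : ℕ} (hm : m ≤ k)
    (hm' : m' ≤ k) (hj : j ≤ m + 1) (hj' : j ≤ m' + 1) :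
    L2norm (iteratedDeriv j W - interpDeriv ξ (4 * n) (node k β σ ε (4 * n) φ) j W) (Ioo 0 2) ≤
      ENNReal.ofReal ((1 + Λ) * (K * (√ε / √β) * ((mu k β ε / n) ^ (m + 1 - j) * (ε ^ m)⁻¹ +
        (4 * ((4 * n : ℕ) : ℝ)⁻¹) ^ (m' + 1 - j) * (ε ^ m')⁻¹ *
          ((4 * n : ℕ) : ℝ)⁻¹ ^ (k - 1)))) := by
  have hε := h.ε_pos
  have hK := hW.K_nonneg hε
  have hn := h.n_pos
  have hφ := h.meshFunction
  have hmu := h.mu_nonneg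
  have hmu' := h.mu_le
  have hΛ := hξ.nonneg
  have hfine := h.L2norm_weakLayer_right_le hξ hW (p := 2 * n) (q := 3 * n) le_rfl (by lia)
    (by lia) hm hj (by positivity)
    fun i h₁ h₂ => (node_succ_sub_node_of_two_mul_le hn hφ h₁ h₂).le
  have hcoarse := h.L2norm_weakLayer_right_le hξ hW (p := 3 * n) (q := 4 * n) (by lia) (by lia)
    le_rfl hm' hj' (by positivity) fun i h₁ _ =>
      (node_succ_sub_node_of_three_mul_le hn hφ h₁).trans_le
        ((by gcongr; linarith : (1 - mu k β ε) / n ≤ 1 / n).trans_eq h.one_div_n)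
  rw [node_two_mul hn hφ, node_three_mul hn hφ, sub_self, mul_zero, Real.exp_zero, mul_one]
    at hfine
  rw [node_three_mul hn hφ, node_four_mul hn hφ, add_sub_cancel_left] at hcoarse
  refine (L2norm_Ioo_le_add _ zero_le_one one_le_two).trans ?_
  rw [h.L2norm_weakLayer_left_eq_zero hξ hW (by lia), zero_add]
  refine (L2norm_Ioo_le_add _ (by linarith) (by linarith)).trans
    ((add_le_add hfine hcoarse).trans ?_)
  rw [← ENNReal.ofReal_add (by positivity) (by positivity), ← mul_add, ← mul_add]
  gcongr
  exact h.exp_mu_le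

lemma L2norm_smooth_le {D : ℕ → ℝ → ℝ} (hD₁ : IsSobolevJet 0 1 (k + 1) D)
    (hD₂ : IsSobolevJet 1 2 (k + 1) D)
    (hK : L2norm (D (k + 1)) (Ioo 0 1) + L2norm (D (k + 1)) (Ioo 1 2) ≤ ENNReal.ofReal K)
    (hj : j ≤ k + 1) :
    L2norm (D j - interpDeriv ξ (4 * n) (node k β σ ε (4 * n) φ) j (D 0)) (Ioo 0 2) ≤
      ENNReal.ofReal ((1 + Λ) *
        (h₁ k β σ ε (4 * n) φ + 4 * ((4 * n : ℕ) : ℝ)⁻¹) ^ (k + 1 - j) * K) := by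
  have hΛ := hξ.nonneg
  have hh := h.h₁_nonneg
  have hN := h.N_pos
  set H := h₁ k β σ ε (4 * n) φ + 4 * ((4 * n : ℕ) : ℝ)⁻¹ with hH
  have hpart : ∀ {p q : ℕ}, p ≤ q → q ≤ 4 * n →
      IsSobolevJet (node k β σ ε (4 * n) φ p) (node k β σ ε (4 * n) φ q) (k + 1) D →
      L2norm (D j - interpDeriv ξ (4 * n) (node k β σ ε (4 * n) φ) j (D 0))
          (Ioo (node k β σ ε (4 * n) φ p) (node k β σ ε (4 * n) φ q)) ≤
        ENNReal.ofReal ((1 + Λ) * H ^ (k + 1 - j)) *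
          L2norm (D (k + 1)) (Ioo (node k β σ ε (4 * n) φ p) (node k β σ ε (4 * n) φ q)) := by
    intro p q hpq hq hD
    refine (hξ.L2norm_sub_interpDeriv_le h.monotone_node hpq hq le_rfl hD hj
      (g := fun y => |H ^ (k + 1 - j) * D (k + 1) y|) fun i _ _ y _ => ?_).trans_eq ?_
    · have hwidth := sub_nonneg.2 (h.monotone_node (Nat.le_succ i))
      rw [abs_mul, abs_of_nonneg (by positivity : 0 ≤ H ^ (k + 1 - j)), hH, ← h.one_div_n]
      gcongr
      exact h.node_succ_sub_node_le i
    · rw [L2norm_abs_const_mul, abs_of_nonneg (by positivity), ← mul_assoc,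
        ← ENNReal.ofReal_mul (by positivity)]
  have hzero := node_zero (k := k) (β := β) (σ := σ) (ε := ε) h.meshFunction
  have hone := node_two_mul (k := k) (β := β) (σ := σ) (ε := ε) h.n_pos h.meshFunction
  have htwo := node_four_mul (k := k) (β := β) (σ := σ) (ε := ε) h.n_pos h.meshFunction
  rw [← hzero, ← hone] at hD₁
  rw [← hone, ← htwo] at hD₂
  have hleft := hpart (Nat.zero_le _) (by lia) hD₁
  have hright := hpart (by lia) le_rfl hD₂
  rw [hzero, hone] at hleft
  rw [hone, htwo] at hright
  refine (L2norm_Ioo_le_add _ zero_le_one one_le_two).trans ((add_le_add hleft hright).trans ?_)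
  rw [← mul_add, ENNReal.ofReal_mul (q := K) (by positivity)]
  gcongr

end IsAdmissible

/-! ### The interpolation error of the solution -/

namespace IsAdmissible

variable {k n j : ℕ} {ξ : Fin (k + 1) → ℝ} {β γ σ ε K K₁ Λ p : ℝ} {φ u S E W g : ℝ → ℝ}

section Powers

variable (h : IsAdmissible k n β σ ε K₁ φ)

include h

lemma inv_N_rpow_le_rpow {Q r : ℝ} (hQ : ((4 * n : ℕ) : ℝ)⁻¹ ≤ Q) (hp : 0 ≤ p) (hpr : p ≤ r) :
    ((4 * n : ℕ) : ℝ)⁻¹ ^ r ≤ Q ^ p :=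
  have hν := inv_pos.2 h.N_pos
  (Real.rpow_le_rpow_of_exponent_ge hν (inv_le_one_of_one_le₀ h.one_le_N) hpr).trans
    (Real.rpow_le_rpow hν.le hQ hp)

lemma inv_N_pow_le_rpow {Q : ℝ} {r : ℕ} (hQ : ((4 * n : ℕ) : ℝ)⁻¹ ≤ Q) (hp : 0 ≤ p)
    (hpr : p ≤ r) : ((4 * n : ℕ) : ℝ)⁻¹ ^ r ≤ Q ^ p :=
  (Real.rpow_natCast _ r).symm.trans_le (h.inv_N_rpow_le_rpow hQ hp hpr)

lemma one_le_inv_sqrt_pow : 1 ≤ (√ε ^ j)⁻¹ :=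
  (one_le_inv₀ (pow_pos (Real.sqrt_pos.2 h.ε_pos) j)).2
    (pow_le_one₀ (Real.sqrt_nonneg ε) (Real.sqrt_le_one.2 h.ε_le_one))

lemma sqrt_mul_inv_pow_le (hj : j ≤ 1) : √ε * (ε ^ j)⁻¹ ≤ (√ε ^ j)⁻¹ := by
  interval_cases j
  · simpa only [pow_zero, inv_one, mul_one] using Real.sqrt_le_one.2 h.ε_le_one
  · rw [pow_one, pow_one, ← div_eq_mul_inv, Real.sqrt_div_self', one_div]

lemma exp_neg_node_le {i : ℕ} (hi : n ≤ i) :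
    Real.exp (-(β / ε) * node k β σ ε (4 * n) φ i) ≤ ((4 * n : ℕ) : ℝ)⁻¹ ^ (k + 1) := by
  refine le_trans (Real.exp_le_exp.2 ?_) h.exp_lam_le
  refine mul_le_mul_of_nonpos_left ?_ (neg_nonpos.2 (div_pos h.β_pos h.ε_pos).le)
  rw [← node_eq_lam (k := k) h.n_pos h.meshFunction]
  exact h.monotone_node hi

lemma smooth_width_pow_le (hp : 0 ≤ p) {r : ℕ} (hpr : p ≤ r) :
    (h₁ k β σ ε (4 * n) φ + 4 * ((4 * n : ℕ) : ℝ)⁻¹) ^ r ≤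
      15 ^ r * (h₁ k β σ ε (4 * n) φ + ((4 * n : ℕ) : ℝ)⁻¹ * maxAbsDerivPsi φ) ^ p := by
  have hh := h.h₁_nonneg
  have hY := h.inv_N_mul_maxAbsDerivPsi_nonneg
  have hνY := h.inv_N_le
  have hν := inv_pos.2 h.N_pos
  have hone_div_n : 4 * ((4 * n : ℕ) : ℝ)⁻¹ ≤ 1 := by
    rw [← h.one_div_n]
    exact div_le_one_of_le₀ (by exact_mod_cast h.n_pos) (by positivity)
  have hpow := pow_le_mul_rpow_mul_exp (B := 2) (c := 4) (θ := 0) (by positivity)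
    (add_le_add (h.h₁_le_lam.trans h.lam_le) hone_div_n |>.trans (by norm_num)) (by norm_num)
    (add_nonneg hh hY) (by rw [Real.exp_zero]; linarith) hp hpr
  rwa [mul_zero, Real.exp_zero, mul_one, (by norm_num : (1 + 2) * (1 + 4 : ℝ) = 15)] at hpow

end Powers

/-- The factor in the bounds for the interpolation error of the strong layer part. -/
def strongConst (k : ℕ) (β σ K K₁ Λ : ℝ) : ℝ :=
  (1 + Λ) * (K * ((1 + K₁) * (1 + layerWidthConst β σ K₁)) ^ (k + 1) * √(2 * σ / β)) +
    2 * ((1 + Λ) * (K * (1 + 1 / √β + 2 / β)))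

/-- The factor in the bounds for the interpolation error of the weak layer part. -/
def weakConst (k : ℕ) (β K Λ : ℝ) : ℝ :=
  (1 + Λ) * (K / √β * (4 * (4 * (1 + 1 / β)) ^ k + 16))

/-- The factor in the bounds for the interpolation error of the solution. -/
def totalConst (k : ℕ) (β σ K K₁ Λ : ℝ) : ℝ :=
  2 * ((1 + Λ) * 15 ^ (k + 1) * K + strongConst k β σ K K₁ Λ + weakConst k β K Λ)

variable (h : IsAdmissible k n β σ ε K₁ φ)

section Constants

include h

lemma strongConst_nonneg (hK : 0 ≤ K) (hΛ : 0 ≤ Λ) : 0 ≤ strongConst k β σ K K₁ Λ := by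
  have hβ := h.β_pos
  have hK₁ := h.K₁_nonneg
  have hc := h.layerWidthConst_nonneg
  unfold strongConst
  positivity

lemma weakConst_nonneg (hK : 0 ≤ K) (hΛ : 0 ≤ Λ) : 0 ≤ weakConst k β K Λ := by
  have hβ := h.β_pos
  unfold weakConst
  positivity

lemma totalConst_nonneg (hK : 0 ≤ K) (hΛ : 0 ≤ Λ) : 0 ≤ totalConst k β σ K K₁ Λ := by
  have hs := h.strongConst_nonneg hK hΛ
  have hw := h.weakConst_nonneg hK hΛ
  unfold totalConst
  positivity

end Constants

variable (hξ : IsReferenceGrid ξ Λ)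

include h hξ

lemma L2norm_strongLayer_coarse_le (hE : IsStrongLayer (k + 1) β ε K E) {a b : ℕ} (ha : n ≤ a)
    (hab : a ≤ b) (hb : b ≤ 4 * n)
    (hlen : node k β σ ε (4 * n) φ b - node k β σ ε (4 * n) φ a ≤ 1) :
    L2norm (E - interp ξ (4 * n) (node k β σ ε (4 * n) φ) E)
        (Ioo (node k β σ ε (4 * n) φ a) (node k β σ ε (4 * n) φ b)) ≤
      ENNReal.ofReal ((1 + Λ) * K * ((4 * n : ℕ) : ℝ)⁻¹ ^ (k + 1)) := by
  have hK := hE.K_nonneg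
  have hΛ := hξ.nonneg
  refine (h.L2norm_strongLayer_tail_le hξ hE hab hb hlen).trans (ENNReal.ofReal_le_ofReal ?_)
  rw [mul_assoc]
  gcongr
  exact h.exp_neg_node_le ha

lemma L2norm_strongLayer_coarse_deriv_le (hE : IsStrongLayer (k + 1) β ε K E) {a b : ℕ}
    (ha : n ≤ a) (hab : a ≤ b) (hb : b ≤ 4 * n)
    (hlen : node k β σ ε (4 * n) φ b - node k β σ ε (4 * n) φ a ≤ 1) (hj : j ≤ 1) :
    L2norm (iteratedDeriv j E - interpDeriv ξ (4 * n) (node k β σ ε (4 * n) φ) j E)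
        (Ioo (node k β σ ε (4 * n) φ a) (node k β σ ε (4 * n) φ b)) ≤
      ENNReal.ofReal ((1 + Λ) * (K * (1 + 1 / √β + 2 / β)) *
        ((√ε ^ j)⁻¹ * ((4 * n : ℕ) : ℝ)⁻¹ ^ (k + 1))) := by
  have hK := hE.K_nonneg
  have hΛ := hξ.nonneg
  have hβ := h.β_pos
  have h_inv_β : 0 ≤ 2 / β := by positivity
  have h_inv_sqrt : 0 ≤ 1 / √β := by positivity
  interval_cases j
  · rw [iteratedDeriv_zero]
    refine (h.L2norm_strongLayer_coarse_le hξ hE ha hab hb hlen).trans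
      (ENNReal.ofReal_le_ofReal ?_)
    rw [pow_zero, inv_one, one_mul]
    gcongr
    exact le_mul_of_one_le_right hK (by linarith)
  · refine (h.L2norm_strongLayer_tail_deriv_le hξ hE hab hb hlen).trans
      (ENNReal.ofReal_le_ofReal ?_)
    have hcoef : K / √β ≤ K * (1 + 1 / √β + 2 / β) := by
      rw [div_eq_mul_one_div]
      gcongr
      linarith
    have hexp := h.exp_neg_node_le ha
    rw [pow_one, ← div_eq_mul_inv, Real.sqrt_div_self', one_div, mul_assoc (1 + Λ)]
    gcongr

lemma L2norm_strongLayer_total_le (hE : IsStrongLayer (k + 1) β ε K E) (hj : j ≤ 1)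
    (hp : 0 ≤ p) (hpj : p ≤ (k + 1 - j : ℕ)) (hpk : p ≤ k + 1 / 2) :
    L2norm (iteratedDeriv j E - interpDeriv ξ (4 * n) (node k β σ ε (4 * n) φ) j E) (Ioo 0 2) ≤
      ENNReal.ofReal (strongConst k β σ K K₁ Λ *
        ((√ε ^ j)⁻¹ * (((4 * n : ℕ) : ℝ)⁻¹ * maxAbsDerivPsi φ) ^ p)) := by
  have hβ := h.β_pos
  have hε := h.ε_pos
  have hn := h.n_pos
  have hφ := h.meshFunction
  have hK := hE.K_nonneg
  have hΛ := hξ.nonneg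
  have hK₁ := h.K₁_nonneg
  have hc := h.layerWidthConst_nonneg
  have hY := h.inv_N_mul_maxAbsDerivPsi_nonneg
  have hlam₀ := h.lam_nonneg
  have hlam := h.lam_le
  have hfine := h.L2norm_strongLayer_fine_le hξ hE (by lia) hp hpj hpk
  have hlam_eq := node_eq_lam (k := k) (β := β) (σ := σ) (ε := ε) hn hφ
  have hone := node_two_mul (k := k) (β := β) (σ := σ) (ε := ε) hn hφ
  have htwo := node_four_mul (k := k) (β := β) (σ := σ) (ε := ε) hn hφ
  have hνY := h.inv_N_pow_le_rpow (r := k + 1) h.inv_N_le hp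
    (hpj.trans (by exact_mod_cast Nat.sub_le _ _))
  have hmid := h.L2norm_strongLayer_coarse_deriv_le hξ hE (a := n) (b := 2 * n) le_rfl (by lia)
    (by lia) (by linarith) hj
  have hright := h.L2norm_strongLayer_coarse_deriv_le hξ hE (a := 2 * n) (b := 4 * n) (by lia)
    (by lia) le_rfl (by linarith) hj
  rw [hlam_eq, hone] at hmid
  rw [hone, htwo] at hright
  refine (L2norm_Ioo_le_add _ zero_le_one one_le_two).trans ((add_le_add_left
    (L2norm_Ioo_le_add _ hlam₀ (by linarith)) _).trans
    ((add_le_add (add_le_add hfine hmid) hright).trans ?_))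
  set Y := ((4 * n : ℕ) : ℝ)⁻¹ * maxAbsDerivPsi φ
  rw [← ENNReal.ofReal_add (by positivity) (by positivity),
    ← ENNReal.ofReal_add (by positivity) (by positivity), add_assoc, ← two_mul, ← mul_assoc 2,
    strongConst, add_mul (_ * _)]
  gcongr
  exact h.sqrt_mul_inv_pow_le hj

lemma L2norm_weakLayer_le_sqrt (hW : IsWeakLayer (k + 1) β ε K W) :
    L2norm (W - interp ξ (4 * n) (node k β σ ε (4 * n) φ) W) (Ioo 0 2) ≤
      ENNReal.ofReal (weakConst k β K Λ * (√ε * ((4 * n : ℕ) : ℝ)⁻¹ ^ k)) := by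
  have hβ := h.β_pos
  have hk := h.one_le_k
  have hε := h.ε_pos
  have hK := hW.K_nonneg hε
  have hΛ := hξ.nonneg
  have hν := inv_pos.2 h.N_pos
  have hbound := h.L2norm_weakLayer_le (j := 0) hξ hW (m := k - 1) (m' := 0) (by lia) k.zero_le
    (by lia) (by lia)
  rw [iteratedDeriv_zero, Nat.sub_add_cancel hk, Nat.sub_zero, zero_add, Nat.sub_zero, pow_one,
    pow_zero, inv_one, mul_one, mul_assoc 4, mul_pow_sub_one (by lia)] at hbound
  refine hbound.trans (ENNReal.ofReal_le_ofReal ?_)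
  have hwidth := h.width_weakLayer_pow_le
  set ν := ((4 * n : ℕ) : ℝ)⁻¹
  have hB : 0 ≤ (4 * (1 + 1 / β)) ^ k := by positivity
  calc (1 + Λ) * (K * (√ε / √β) * ((mu k β ε / n) ^ k * (ε ^ (k - 1))⁻¹ + 4 * ν ^ k))
      ≤ (1 + Λ) * (K * (√ε / √β) * ((4 * (1 + 1 / β)) ^ k * ν ^ k + 4 * ν ^ k)) := by
        gcongr
    _ = (1 + Λ) * (K / √β * ((4 * (1 + 1 / β)) ^ k + 4)) * (√ε * ν ^ k) := by ring
    _ ≤ weakConst k β K Λ * (√ε * ν ^ k) := by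
        unfold weakConst
        gcongr
        all_goals linarith

lemma L2norm_weakLayer_le_inv_sqrt (hW : IsWeakLayer (k + 1) β ε K W) (hj : j ≤ 1) :
    L2norm (iteratedDeriv j W - interpDeriv ξ (4 * n) (node k β σ ε (4 * n) φ) j W) (Ioo 0 2) ≤
      ENNReal.ofReal (weakConst k β K Λ * ((√ε)⁻¹ * ((4 * n : ℕ) : ℝ)⁻¹ ^ (k + 1 - j))) := by
  have hβ := h.β_pos
  have hε := h.ε_pos
  have hk := h.one_le_k
  have hK := hW.K_nonneg hε
  have hΛ := hξ.nonneg
  have hν := inv_pos.2 h.N_pos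
  refine (h.L2norm_weakLayer_le hξ hW (m := k) (m' := 1) le_rfl hk (by lia) (by lia)).trans
    (ENNReal.ofReal_le_ofReal ?_)
  have hfine := h.width_weakLayer_pow_le_inv hj
  set ν := ((4 * n : ℕ) : ℝ)⁻¹
  have hcoarse : (4 * ν) ^ (1 + 1 - j) * (ε ^ 1)⁻¹ * ν ^ (k - 1) ≤
      16 * (ε⁻¹ * ν ^ (k + 1 - j)) :=
    calc (4 * ν) ^ (1 + 1 - j) * (ε ^ 1)⁻¹ * ν ^ (k - 1)
        = 4 ^ (1 + 1 - j) * (ε⁻¹ * ν ^ (k + 1 - j)) := by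
          rw [(by lia : k + 1 - j = 1 + 1 - j + (k - 1)), pow_add ν, mul_pow 4 ν, pow_one]
          ring
      _ ≤ 16 * (ε⁻¹ * ν ^ (k + 1 - j)) := by
          gcongr
          interval_cases j <;> norm_num
  calc _ ≤ (1 + Λ) * (K * (√ε / √β) * (4 * (4 * (1 + 1 / β)) ^ k * (ε⁻¹ * ν ^ (k + 1 - j)) +
        16 * (ε⁻¹ * ν ^ (k + 1 - j)))) := by gcongr
    _ = weakConst k β K Λ * (√ε / ε * ν ^ (k + 1 - j)) := by
        unfold weakConst
        ring
    _ = weakConst k β K Λ * ((√ε)⁻¹ * ν ^ (k + 1 - j)) := by rw [Real.sqrt_div_self', one_div]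

/-- For `j = 0` the smaller of the two bounds on the weak layer part wins: their geometric mean is
independent of `ε`. -/
lemma L2norm_weakLayer_total_le (hW : IsWeakLayer (k + 1) β ε K W) (hj : j ≤ 1) {Q : ℝ}
    (hQ : ((4 * n : ℕ) : ℝ)⁻¹ ≤ Q) (hp : 0 ≤ p) (hpj : p ≤ (k + 1 - j : ℕ))
    (hpk : p ≤ k + 1 / 2) :
    L2norm (iteratedDeriv j W - interpDeriv ξ (4 * n) (node k β σ ε (4 * n) φ) j W) (Ioo 0 2) ≤
      ENNReal.ofReal (weakConst k β K Λ * ((√ε ^ j)⁻¹ * Q ^ p)) := by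
  have hε := h.ε_pos
  have hw := h.weakConst_nonneg (hW.K_nonneg hε) hξ.nonneg
  have hν := inv_pos.2 h.N_pos
  have hbound := h.L2norm_weakLayer_le_inv_sqrt hξ hW hj
  interval_cases j
  · have hmean : √((4 * n : ℕ) : ℝ)⁻¹ * ((4 * n : ℕ) : ℝ)⁻¹ ^ k ≤ Q ^ p := by
      rw [Real.sqrt_eq_rpow, ← Real.rpow_natCast, ← Real.rpow_add hν]
      exact h.inv_N_rpow_le_rpow hQ hp (by linarith)
    rw [pow_zero, inv_one, one_mul]
    rcases le_total ε ((4 * n : ℕ) : ℝ)⁻¹ with hεν | hνε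
    · refine (h.L2norm_weakLayer_le_sqrt hξ hW).trans (ENNReal.ofReal_le_ofReal ?_)
      gcongr
      exact le_trans (by gcongr) hmean
    · refine hbound.trans (ENNReal.ofReal_le_ofReal ?_)
      gcongr
      refine le_trans ?_ hmean
      rw [Nat.sub_zero, pow_succ', ← mul_assoc]
      gcongr
      rw [inv_mul_le_iff₀ (Real.sqrt_pos.2 hε)]
      calc ((4 * n : ℕ) : ℝ)⁻¹ = √((4 * n : ℕ) : ℝ)⁻¹ * √((4 * n : ℕ) : ℝ)⁻¹ :=
            (Real.mul_self_sqrt hν.le).symm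
        _ ≤ √ε * √((4 * n : ℕ) : ℝ)⁻¹ := by gcongr
  · refine hbound.trans (ENNReal.ofReal_le_ofReal ?_)
    rw [pow_one]
    gcongr
    exact h.inv_N_pow_le_rpow hQ hp hpj

lemma L2norm_smooth_total_le {D : ℕ → ℝ → ℝ} (hD₁ : IsSobolevJet 0 1 (k + 1) D)
    (hD₂ : IsSobolevJet 1 2 (k + 1) D) (hK : 0 ≤ K)
    (hDK : L2norm (D (k + 1)) (Ioo 0 1) + L2norm (D (k + 1)) (Ioo 1 2) ≤ ENNReal.ofReal K)
    (hj : j ≤ k + 1) (hp : 0 ≤ p) (hpj : p ≤ (k + 1 - j : ℕ)) :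
    L2norm (D j - interpDeriv ξ (4 * n) (node k β σ ε (4 * n) φ) j (D 0)) (Ioo 0 2) ≤
      ENNReal.ofReal ((1 + Λ) * 15 ^ (k + 1) * K * ((√ε ^ j)⁻¹ *
        (h₁ k β σ ε (4 * n) φ + ((4 * n : ℕ) : ℝ)⁻¹ * maxAbsDerivPsi φ) ^ p)) := by
  have hΛ := hξ.nonneg
  have hQ := add_nonneg h.h₁_nonneg h.inv_N_mul_maxAbsDerivPsi_nonneg
  have hwidth := h.smooth_width_pow_le hp hpj
  have hsqrt := h.one_le_inv_sqrt_pow (j := j)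
  refine (h.L2norm_smooth_le hξ hD₁ hD₂ hDK hj).trans (ENNReal.ofReal_le_ofReal ?_)
  set Q := h₁ k β σ ε (4 * n) φ + ((4 * n : ℕ) : ℝ)⁻¹ * maxAbsDerivPsi φ
  calc (1 + Λ) * (h₁ k β σ ε (4 * n) φ + 4 * ((4 * n : ℕ) : ℝ)⁻¹) ^ (k + 1 - j) * K
      ≤ (1 + Λ) * (15 ^ (k + 1 - j) * Q ^ p) * K := by gcongr
    _ = (1 + Λ) * 15 ^ (k + 1 - j) * K * (1 * Q ^ p) := by ring
    _ ≤ (1 + Λ) * 15 ^ (k + 1) * K * ((√ε ^ j)⁻¹ * Q ^ p) := by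
        gcongr
        · norm_num
        · exact Nat.sub_le _ _

section Solution

variable {D : ℕ → ℝ → ℝ} (hD₁ : IsSobolevJet 0 1 (k + 1) D) (hD₂ : IsSobolevJet 1 2 (k + 1) D)
  (hE : IsStrongLayer (k + 1) β ε K E) (hW : IsWeakLayer (k + 1) β ε K W)

include hD₁ hD₂ hE hW

lemma L2norm_error_le_add (hu : EqOn u (D 0 + (E + W)) (Ioo 0 1 ∪ Ioo 1 2)) (hj : j ≤ k + 1)
    (hg : EqOn g (D j + (iteratedDeriv j E + iteratedDeriv j W)) (Ioo 0 1 ∪ Ioo 1 2)) :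
    L2norm (g - interpDeriv ξ (4 * n) (node k β σ ε (4 * n) φ) j u) (Ioo 0 2) ≤
      2 * (L2norm (D j - interpDeriv ξ (4 * n) (node k β σ ε (4 * n) φ) j (D 0)) (Ioo 0 2) +
        (L2norm (iteratedDeriv j E - interpDeriv ξ (4 * n) (node k β σ ε (4 * n) φ) j E)
            (Ioo 0 2) +
          L2norm (iteratedDeriv j W - interpDeriv ξ (4 * n) (node k β σ ε (4 * n) φ) j W)
            (Ioo 0 2))) := by
  have hβ := h.β_pos
  have hε := h.ε_pos
  have hpart : ∀ {a b : ℕ}, a ≤ b → b ≤ 4 * n →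
      Ioo (node k β σ ε (4 * n) φ a) (node k β σ ε (4 * n) φ b) ⊆ Ioo 0 1 ∪ Ioo 1 2 →
      IsSobolevJet (node k β σ ε (4 * n) φ a) (node k β σ ε (4 * n) φ b) (k + 1) D →
      IsSobolevJet (node k β σ ε (4 * n) φ a) (node k β σ ε (4 * n) φ b) (k + 1)
        (fun ℓ => iteratedDeriv ℓ W) →
      L2norm (g - interpDeriv ξ (4 * n) (node k β σ ε (4 * n) φ) j u)
          (Ioo (node k β σ ε (4 * n) φ a) (node k β σ ε (4 * n) φ b)) ≤
        L2norm (D j - interpDeriv ξ (4 * n) (node k β σ ε (4 * n) φ) j (D 0)) (Ioo 0 2) +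
          (L2norm (iteratedDeriv j E - interpDeriv ξ (4 * n) (node k β σ ε (4 * n) φ) j E)
              (Ioo 0 2) +
            L2norm (iteratedDeriv j W - interpDeriv ξ (4 * n) (node k β σ ε (4 * n) φ) j W)
              (Ioo 0 2)) := by
    intro a b hab hb hsub hDab hWab
    have ha₀ := (h.node_mem_Icc (hab.trans hb)).1
    have hb₂ := (h.node_mem_Icc hb).2
    have hEab := (hE.isSobolevJet hβ hε).mono ha₀ hb₂ le_rfl
    have hinner := hξ.L2norm_sub_interpDeriv_le_add h.monotone_node hab hb hEab hWab hj
      (eqOn_refl _ _) (eqOn_refl _ _)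
    have houter := hξ.L2norm_sub_interpDeriv_le_add h.monotone_node hab hb hDab (hEab.add hWab) hj
      (hu.mono hsub) (hg.mono hsub)
    simp only [iteratedDeriv_zero] at hinner houter
    have hmono := Ioo_subset_Ioo ha₀ hb₂
    refine houter.trans ((add_le_add_right hinner _).trans ?_)
    gcongr <;> exact L2norm_mono_set hmono
  have hzero := node_zero (k := k) (β := β) (σ := σ) (ε := ε) h.meshFunction
  have hone := node_two_mul (k := k) (β := β) (σ := σ) (ε := ε) h.n_pos h.meshFunction
  have htwo := node_four_mul (k := k) (β := β) (σ := σ) (ε := ε) h.n_pos h.meshFunction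
  have hleft := hpart (a := 0) (b := 2 * n) (by lia) (by lia)
  have hright := hpart (a := 2 * n) (b := 4 * n) (by lia) le_rfl
  rw [hzero, hone] at hleft
  rw [hone, htwo] at hright
  rw [two_mul]
  exact (L2norm_Ioo_le_add _ zero_le_one one_le_two).trans (add_le_add
    (hleft subset_union_left hD₁ hW.isSobolevJet_left)
    (hright subset_union_right hD₂ (hW.isSobolevJet_right hβ hε)))

lemma L2norm_error_le
    (hDK : L2norm (D (k + 1)) (Ioo 0 1) + L2norm (D (k + 1)) (Ioo 1 2) ≤ ENNReal.ofReal K)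
    (hu : EqOn u (D 0 + (E + W)) (Ioo 0 1 ∪ Ioo 1 2)) (hj : j ≤ 1)
    (hg : EqOn g (D j + (iteratedDeriv j E + iteratedDeriv j W)) (Ioo 0 1 ∪ Ioo 1 2))
    (hp : 0 ≤ p) (hpj : p ≤ (k + 1 - j : ℕ)) (hpk : p ≤ k + 1 / 2) :
    L2norm (g - interpDeriv ξ (4 * n) (node k β σ ε (4 * n) φ) j u) (Ioo 0 2) ≤
      ENNReal.ofReal (totalConst k β σ K K₁ Λ * ((√ε ^ j)⁻¹ *
        (h₁ k β σ ε (4 * n) φ + ((4 * n : ℕ) : ℝ)⁻¹ * maxAbsDerivPsi φ) ^ p)) := by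
  have hK := hE.K_nonneg
  have hΛ := hξ.nonneg
  have hh := h.h₁_nonneg
  have hY := h.inv_N_mul_maxAbsDerivPsi_nonneg
  have hs := h.strongConst_nonneg hK hΛ
  have hw := h.weakConst_nonneg hK hΛ
  have hsmooth := h.L2norm_smooth_total_le hξ hD₁ hD₂ hK hDK (by lia) hp hpj
  have hstrong := h.L2norm_strongLayer_total_le hξ hE hj hp hpj hpk
  have hweak := h.L2norm_weakLayer_total_le hξ hW hj
    (h.inv_N_le.trans (le_add_of_nonneg_left hh)) hp hpj hpk
  refine (h.L2norm_error_le_add hξ hD₁ hD₂ hE hW hu (by lia) hg).trans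
    ((mul_le_mul_right (add_le_add hsmooth (add_le_add hstrong hweak)) _).trans ?_)
  set Y := ((4 * n : ℕ) : ℝ)⁻¹ * maxAbsDerivPsi φ
  set Q := h₁ k β σ ε (4 * n) φ + Y
  have hYQ : Y ≤ Q := le_add_of_nonneg_left hh
  rw [← ENNReal.ofReal_add (by positivity) (by positivity),
    ← ENNReal.ofReal_add (by positivity) (by positivity), ← ENNReal.ofReal_ofNat,
    ← ENNReal.ofReal_mul zero_le_two]
  refine ENNReal.ofReal_le_ofReal ?_
  calc _ ≤ 2 * ((1 + Λ) * 15 ^ (k + 1) * K * ((√ε ^ j)⁻¹ * Q ^ p) +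
        (strongConst k β σ K K₁ Λ * ((√ε ^ j)⁻¹ * Q ^ p) +
          weakConst k β K Λ * ((√ε ^ j)⁻¹ * Q ^ p))) := by gcongr
    _ = totalConst k β σ K K₁ Λ * ((√ε ^ j)⁻¹ * Q ^ p) := by
        unfold totalConst
        ring

lemma hasWeakDeriv_error (hc : ContinuousOn u (Icc 0 2))
    (hu : EqOn u (D 0 + (E + W)) (Ioo 0 1 ∪ Ioo 1 2)) :
    HasWeakDeriv 0 2 (u - interp ξ (4 * n) (node k β σ ε (4 * n) φ) u)
      (D 1 + (iteratedDeriv 1 E + iteratedDeriv 1 W) -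
        interpDeriv ξ (4 * n) (node k β σ ε (4 * n) φ) 1 u) := by
  have hβ := h.β_pos
  have hε := h.ε_pos
  have hE' := hE.isSobolevJet hβ hε
  have hleft := (hD₁.add ((hE'.mono le_rfl one_le_two le_rfl).add hW.isSobolevJet_left)).update_zero
    (u := u) (by simpa only [iteratedDeriv_zero] using hu.mono subset_union_left)
  have hright := (hD₂.add ((hE'.mono zero_le_one le_rfl le_rfl).add
    (hW.isSobolevJet_right hβ hε))).update_zero
    (u := u) (by simpa only [iteratedDeriv_zero] using hu.mono subset_union_right)
  have hzero := node_zero (k := k) (β := β) (σ := σ) (ε := ε) h.meshFunction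
  have hone := node_two_mul (k := k) (β := β) (σ := σ) (ε := ε) h.n_pos h.meshFunction
  have htwo := node_four_mul (k := k) (β := β) (σ := σ) (ε := ε) h.n_pos h.meshFunction
  have hcells : ∀ i < 4 * n, IsSobolevJet (node k β σ ε (4 * n) φ i)
      (node k β σ ε (4 * n) φ (i + 1)) (k + 1)
      (Function.update (fun ℓ => D ℓ + (iteratedDeriv ℓ E + iteratedDeriv ℓ W)) 0 u) := by
    intro i hi
    rcases lt_or_ge i (2 * n) with hi₁ | hi₁
    · exact hleft.mono (h.node_mem_Icc hi.le).1 (hone ▸ h.monotone_node hi₁) le_rfl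
    · exact hright.mono (hone ▸ h.monotone_node hi₁) (h.node_mem_Icc hi).2 le_rfl
  have herror := hξ.hasWeakDeriv_sub_interp (m := k) h.monotone_node
    (by rw [hzero, htwo]; exact zero_lt_two) hcells
    (by rwa [hzero, htwo, Function.update_self])
  rwa [hzero, htwo, Function.update_self, Function.update_of_ne one_ne_zero] at herror

end Solution

lemma exists_hasWeakDeriv_error_le (hd : IsDecomposition (k + 1) β ε K u S E W) :
    (∀ p : ℝ, 0 ≤ p → p ≤ k + 1 / 2 →
      L2norm (u - interp ξ (4 * n) (node k β σ ε (4 * n) φ) u) (Ioo 0 2) ≤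
        ENNReal.ofReal (totalConst k β σ K K₁ Λ *
          (h₁ k β σ ε (4 * n) φ + ((4 * n : ℕ) : ℝ)⁻¹ * maxAbsDerivPsi φ) ^ p)) ∧
      ∃ g, HasWeakDeriv 0 2 (u - interp ξ (4 * n) (node k β σ ε (4 * n) φ) u) g ∧
        L2norm g (Ioo 0 2) ≤ ENNReal.ofReal (totalConst k β σ K K₁ Λ * ((√ε)⁻¹ *
          (h₁ k β σ ε (4 * n) φ + ((4 * n : ℕ) : ℝ)⁻¹ * maxAbsDerivPsi φ) ^ k)) := by
  have hE := hd.isStrongLayer h.ε_pos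
  have hW := hd.isWeakLayer h.ε_pos
  obtain ⟨D, rfl, hD₁, hD₂, hDK⟩ := hd.bound_S.exists_isSobolevJet
  have hu : EqOn u (D 0 + (E + W)) (Ioo 0 1 ∪ Ioo 1 2) := fun y hy =>
    (hd.eq_add y hy).trans (add_assoc _ _ _)
  refine ⟨fun p hp hpk => ?_, _, h.hasWeakDeriv_error hξ hD₁ hD₂ hE hW hd.continuousOn_u hu, ?_⟩
  · have hvalue := h.L2norm_error_le hξ hD₁ hD₂ hE hW (hDK _ le_rfl) hu zero_le_one
      (by simpa only [iteratedDeriv_zero] using hu) hp (by push_cast; linarith) hpk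
    rwa [pow_zero, inv_one, one_mul] at hvalue
  · have hderiv := h.L2norm_error_le hξ hD₁ hD₂ hE hW (hDK _ le_rfl) hu le_rfl (eqOn_refl _ _)
      k.cast_nonneg (by rw [Nat.add_sub_cancel]) (by linarith)
    rwa [pow_one, Real.rpow_natCast] at hderiv

lemma energyNorm_error_le (hγ : 0 ≤ γ) (hd : IsDecomposition (k + 1) β ε K u S E W) :
    energyNorm ε γ (u - interp ξ (4 * n) (node k β σ ε (4 * n) φ) u) ≤
      ENNReal.ofReal (√(1 + γ) * totalConst k β σ K K₁ Λ *
        (h₁ k β σ ε (4 * n) φ + ((4 * n : ℕ) : ℝ)⁻¹ * maxAbsDerivPsi φ) ^ k) := by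
  have hε := h.ε_pos
  have hT := h.totalConst_nonneg (hd.isStrongLayer hε).K_nonneg hξ.nonneg
  have hQ := add_nonneg h.h₁_nonneg h.inv_N_mul_maxAbsDerivPsi_nonneg
  obtain ⟨hvalue, g, hg, hderiv⟩ := h.exists_hasWeakDeriv_error_le hξ hd
  have hvalue := hvalue k k.cast_nonneg (by linarith)
  rw [Real.rpow_natCast] at hvalue
  set T := totalConst k β σ K K₁ Λ
  set Q := h₁ k β σ ε (4 * n) φ + ((4 * n : ℕ) : ℝ)⁻¹ * maxAbsDerivPsi φ
  have hsq : ε * (T * ((√ε)⁻¹ * Q ^ k)) ^ 2 = (T * Q ^ k) ^ 2 := by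
    rw [mul_left_comm T, mul_pow, inv_pow, Real.sq_sqrt hε.le, mul_inv_cancel_left₀ hε.ne']
  refine (iInf₂_le g hg).trans ?_
  calc _ ≤ (ENNReal.ofReal ε * ENNReal.ofReal (T * ((√ε)⁻¹ * Q ^ k)) ^ 2 +
        ENNReal.ofReal γ * ENNReal.ofReal (T * Q ^ k) ^ 2) ^ (1 / 2 : ℝ) := by gcongr
    _ = ENNReal.ofReal ((1 + γ) * (T * Q ^ k) ^ 2) ^ (1 / 2 : ℝ) := by
        rw [← ENNReal.ofReal_pow (by positivity), ← ENNReal.ofReal_pow (by positivity),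
          ← ENNReal.ofReal_mul hε.le, ← ENNReal.ofReal_mul hγ,
          ← ENNReal.ofReal_add (by positivity) (by positivity), hsq, one_add_mul]
    _ = ENNReal.ofReal (√(1 + γ) * T * Q ^ k) := by
        rw [ENNReal.ofReal_rpow_of_nonneg (by positivity) (by norm_num), ← Real.sqrt_eq_rpow,
          Real.sqrt_mul (by positivity), Real.sqrt_sq (by positivity), mul_assoc]

lemma L2norm_strongLayer_coarse_union_le (hE : IsStrongLayer (k + 1) β ε K E) :
    L2norm (E - interp ξ (4 * n) (node k β σ ε (4 * n) φ) E)
        (Ioo (lam β σ ε (4 * n)) 1 ∪ Ioo (1 + mu k β ε) 2) ≤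
      ENNReal.ofReal (2 * ((1 + Λ) * K) * ((4 * n : ℕ) : ℝ)⁻¹ ^ (k + 1)) := by
  have hn := h.n_pos
  have hφ := h.meshFunction
  have hK := hE.K_nonneg
  have hΛ := hξ.nonneg
  have hlam := h.lam_nonneg
  have hmu := h.mu_nonneg
  have hleft := h.L2norm_strongLayer_coarse_le hξ hE (a := n) (b := 2 * n) le_rfl (by lia) (by lia)
  have hright := h.L2norm_strongLayer_coarse_le hξ hE (a := 3 * n) (b := 4 * n) (by lia) (by lia)
    le_rfl
  rw [node_eq_lam hn hφ, node_two_mul hn hφ] at hleft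
  rw [node_three_mul hn hφ, node_four_mul hn hφ] at hright
  refine (L2norm_union_le _ _ _).trans
    ((add_le_add (hleft (by linarith)) (hright (by linarith))).trans_eq ?_)
  rw [← ENNReal.ofReal_add (by positivity) (by positivity), ← two_mul, mul_assoc 2]

lemma L2norm_strongLayer_fine_union_le (hE : IsStrongLayer (k + 1) β ε K E) :
    L2norm (E - interp ξ (4 * n) (node k β σ ε (4 * n) φ) E)
        (Ioo 0 (lam β σ ε (4 * n)) ∪ Ioo 1 (1 + mu k β ε)) ≤
      ENNReal.ofReal (strongConst k β σ K K₁ Λ *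
        (√ε * (((4 * n : ℕ) : ℝ)⁻¹ * maxAbsDerivPsi φ) ^ k)) := by
  have hn := h.n_pos
  have hβ := h.β_pos
  have hφ := h.meshFunction
  have hK := hE.K_nonneg
  have hΛ := hξ.nonneg
  have hK₁ := h.K₁_nonneg
  have hc := h.layerWidthConst_nonneg
  have hY := h.inv_N_mul_maxAbsDerivPsi_nonneg
  have hmu := h.mu_le
  have hν_pow := h.inv_N_pow_le_rpow (r := k + 1) (p := k) h.inv_N_le k.cast_nonneg (by simp)
  have hleft := h.L2norm_strongLayer_fine_le hξ hE (j := 0) (p := k) (by lia)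
    k.cast_nonneg (by simp)
    (by linarith)
  rw [iteratedDeriv_zero, pow_zero, inv_one, mul_one, Real.rpow_natCast] at hleft
  rw [Real.rpow_natCast] at hν_pow
  have hright := h.L2norm_strongLayer_tail_le hξ hE (p := 2 * n) (q := 3 * n) (by lia) (by lia)
  rw [node_two_mul hn hφ, node_three_mul hn hφ, mul_one] at hright
  refine (L2norm_union_le _ _ _).trans
    ((add_le_add hleft (hright (by linarith))).trans ?_)
  have hexp := h.exp_le_sqrt
  set Y := ((4 * n : ℕ) : ℝ)⁻¹ * maxAbsDerivPsi φ
  rw [← ENNReal.ofReal_add (by positivity) (by positivity), strongConst, add_mul (_ * _)]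
  refine ENNReal.ofReal_le_ofReal (add_le_add_right ?_ _)
  have hsqrtβ : 0 ≤ 1 / √β := by positivity
  calc (1 + Λ) * (K * Real.exp (-(β / ε)))
      ≤ (1 + Λ) * (K * (2 / β * √ε * Y ^ k)) := by
        gcongr
        exact hexp.trans (by gcongr)
    _ = 1 * ((1 + Λ) * (K * (2 / β))) * (√ε * Y ^ k) := by ring
    _ ≤ 2 * ((1 + Λ) * (K * (1 + 1 / √β + 2 / β))) * (√ε * Y ^ k) := by
        gcongr
        · exact one_le_two
        · linarith

end IsAdmissible

end CoarseMesh

end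

theorem mainTheorem5 (k : ℕ) (hk : 1 ≤ k)
    (ξ : Fin (k + 1) → ℝ) (hξ : StrictMono ξ) (hξ0 : ξ 0 = 0) (hξ1 : ξ (Fin.last k) = 1)
    (β γ σ : ℝ) (hβ : 0 < β) (hγ : 0 < γ) (hσ : (k : ℝ) + 1 ≤ σ) (K K₁ : ℝ) :
    ∃ C : ℝ, 0 < C ∧
      ∀ (ε : ℝ) (N : ℕ) (φ : ℝ → ℝ) (u S E W : ℝ → ℝ),
        0 < ε → ε ≤ 1 → 0 < N → 4 ∣ N →
        CoarseMesh.IsMeshFunction N φ →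
        CoarseMesh.lam β σ ε N ≤ 1 / 2 →
        CoarseMesh.mu k β ε ≤ 1 / 2 →
        CoarseMesh.h₁ k β σ ε N φ ≤ K₁ * ε →
        Real.exp (-ε ^ (-1 / (k : ℝ))) ≤ (N : ℝ) ^ (1 - (k : ℝ)) →
        CoarseMesh.IsDecomposition (k + 1) β ε K u S E W →
        let lam : ℝ := CoarseMesh.lam β σ ε N
        let mu : ℝ := CoarseMesh.mu k β ε
        let h₁ : ℝ := CoarseMesh.h₁ k β σ ε N φ
        let M : ℝ := CoarseMesh.maxAbsDerivPsi φ
        let I : (ℝ → ℝ) → ℝ → ℝ := CoarseMesh.interp ξ N (CoarseMesh.node k β σ ε N φ)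
        CoarseMesh.L2norm (u - I u) (Ioo 0 2)
            ≤ ENNReal.ofReal (C * (h₁ + (N : ℝ)⁻¹ * M) ^ ((k : ℝ) + 1 / 2)) ∧
        CoarseMesh.energyNorm ε γ (u - I u)
            ≤ ENNReal.ofReal (C * (h₁ + (N : ℝ)⁻¹ * M) ^ k) ∧
        CoarseMesh.L2norm (W - I W) (Ioo 0 2)
            ≤ ENNReal.ofReal (C * (ε ^ (1 / 2 : ℝ) * (N : ℝ)⁻¹ ^ k)) ∧
        CoarseMesh.L2norm (E - I E) (Ioo lam 1 ∪ Ioo (1 + mu) 2)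
            ≤ ENNReal.ofReal (C * (N : ℝ)⁻¹ ^ (k + 1)) ∧
        CoarseMesh.L2norm (E - I E) (Ioo 0 lam ∪ Ioo 1 (1 + mu))
            ≤ ENNReal.ofReal (C * (ε ^ (1 / 2 : ℝ) * ((N : ℝ)⁻¹ * M) ^ k)) := by
  obtain ⟨Λ, hΛ⟩ := CoarseMesh.IsReferenceGrid.exists_of_strictMono hξ hξ0 hξ1
  obtain ⟨C, hC⟩ := (Set.toFinite {1, CoarseMesh.IsAdmissible.totalConst k β σ K K₁ Λ,
    √(1 + γ) * CoarseMesh.IsAdmissible.totalConst k β σ K K₁ Λ,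
    CoarseMesh.IsAdmissible.weakConst k β K Λ, 2 * ((1 + Λ) * K),
    CoarseMesh.IsAdmissible.strongConst k β σ K K₁ Λ}).bddAbove
  simp only [mem_upperBounds, mem_insert_iff, mem_singleton_iff, forall_eq_or_imp, forall_eq] at hC
  obtain ⟨hone, htotal, henergy, hweak, hcoarse, hfine⟩ := hC
  refine ⟨C, one_pos.trans_le hone, ?_⟩
  rintro ε _ φ u S E W hε hε1 hN ⟨n, rfl⟩ hφ hlam hmu hh₁ hexp hd
  have h : CoarseMesh.IsAdmissible k n β σ ε K₁ φ :=
    ⟨hk, by lia, hβ, hσ, hε, hε1, hφ, hlam, hmu, hh₁, hexp⟩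
  have hE := hd.isStrongLayer hε
  have hW := hd.isWeakLayer hε
  have hY := h.inv_N_mul_maxAbsDerivPsi_nonneg
  have hQ := add_nonneg h.h₁_nonneg hY
  have henlarge {L : ℝ≥0∞} {c X : ℝ} (hc : c ≤ C) (hX : 0 ≤ X) (hL : L ≤ ENNReal.ofReal (c * X)) :
      L ≤ ENNReal.ofReal (C * X) :=
    hL.trans (ENNReal.ofReal_le_ofReal (mul_le_mul_of_nonneg_right hc hX))
  rw [← Real.sqrt_eq_rpow]
  exact ⟨henlarge htotal (by positivity)
      ((h.exists_hasWeakDeriv_error_le hΛ hd).1 _ (by positivity) le_rfl),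
    henlarge henergy (by positivity) (h.energyNorm_error_le hΛ hγ.le hd),
    henlarge hweak (by positivity) (h.L2norm_weakLayer_le_sqrt hΛ hW),
    henlarge hcoarse (by positivity) (h.L2norm_strongLayer_coarse_union_le hΛ hE),
    henlarge hfine (by positivity) (h.L2norm_strongLayer_fine_union_le hΛ hE)⟩
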